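/- **Setting.** Fix finite nonempty sets $\mathcal S,\mathcal A$ with $S=|\mathcal S|$, $A=|\mathcal A|$, a horizon $H\ge 1$, an initial state $s^1\in\mathcal S$, a measurable context space $\mathcal C$ and a probability distribution $\mathcal D$ on $\mathcal C$. A (reward-free) model $M$ consists of transition probabilities $P_M^h(\cdot\mid s,a;c)\in\Delta(\mathcal S)$, $h\in[H]$, measurable in $c$. A policy is $\pi=(\pi^1,\dots,\pi^H)$ with $\pi^h:\mathcal S\to\Delta(\mathcal A)$. $M(\pi,c)$ is the law of the trajectory $s^1,a^1,\dots,s^H,a^H$ with $a^h\sim\pi^h(s^h)$, $s^{h+1}\sim P_M^h(\cdot\mid s^h,a^h;c)$. For a reward distribution $R=(R^h(s,a;c))$, $R^h(s,a;c)\in\Delta([0,1])$, let $M(\pi,c;R)$ be the law of the trajectory together with independent rewards $r^h\sim R^h(s^h,a^h;c)$, and $V_M(\pi,c,R)=\mathbb E^{M(\pi,c;R)}\big[\sum_{h=1}^H r^h\big]$. Let $\mathcal M$ be a finite set of models, containing the unknown true model $M_\star$, and let $\delta\in(0,1/2)$, $\varepsilon>0$. **Oracle.** Given $(c_i,\pi_i,x_i)_{i\le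 n}$, with trajectories $x_i$, the oracle $\mathsf{MLE}_{\mathcal M}$ returns a maximizer over $M\in\mathcal M$ of $\prod_i \mathbb P^{M,\pi_i,c_i}(x_i)$. Its error rate, given to the algorithm, is $\mathcal E_{\mathcal M,\delta'}(n)=\kappa\log(|\mathcal M|/\delta')/n$ for $n\ge1$ with a constant $\kappa>0$, and $\mathcal E_{\mathcal M,\delta'}(0)=1$. **LOLIPOP** with epoch schedule $0=\tau_{-1}=\tau_0<\tau_1<\dots<\tau_N$. Let $\widehat M_0$ be any model. In epoch $m=1,\dots,N$ put $\mathcal E_m=\mathcal E_{\mathcal M,\delta/(2N^2)}(\tau_{m-1}-\tau_{m-2})$, $\gamma_m=\sqrt{H^6S^4A^3/\mathcal E_m}$, $\eta_m=\gamma_m/(720eH^5S^3A^2)$, $\zeta_m=\gamma_m/(8eH(H+1)^2)$, and $\widehat{\mathrm{reg}}_{m-1}(\pi,c)=\max_{\pi'}V_{\widehat M_{m-1}}(\pi',c,0)-V_{\widehat M_{m-1}}(\pi,c,0)$. For the segments $h=1,\dots,H$ in order: 1. From the layers $\widehat P_m^j$, $j<h$, estimated earlier in the epoch, define $\widetilde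 d_m^1(s;\pi,c)=\mathbb 1(s=s^1)$, $\widetilde d_m^j(s,a;\pi,c)=\widetilde d_m^j(s;\pi,c)\,\pi^j(a\mid s)$, the trusted transitions $$\widetilde{\mathcal T}_m^j(c)=\Big\{(s,a,s'):\max_\pi \frac{\widetilde d_m^j(s,a;\pi,c)}{SA+\eta_m\widehat{\mathrm{reg}}_{m-1}(\pi,c)}\,\widehat P_m^j(s'\mid s,a;c)\ge \frac1{\zeta_m}\Big\},$$ and $\widetilde d_m^{j+1}(s;\pi,c)=\sum_{(s',a'):(s',a',s)\in\widetilde{\mathcal T}_m^j(c)}\widetilde d_m^j(s',a';\pi,c)\widehat P_m^j(s\mid s',a';c)$. 2. For each context $c$ let $\Pi_m^h(c)$ be the set of policies consisting of a maximizer of $V_{\widehat M_{m-1}}(\cdot,c,0)$ and, for all $s,a$, a maximizer $\pi_{m,c}^{h,s,a}$ of $\pi\mapsto \widetilde d_m^h(s,a;\pi,c)/(SA+\eta_m\widehat{\mathrm{reg}}_{m-1}(\pi,c))$, and let $p_m^h(c)$ be the distribution on $\Pi_m^h(c)$ with weights $1/(\lambda+\eta_m\widehat{\mathrm{reg}}_{m-1}(\pi,c))$,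 where $\lambda>0$ normalizes it. 3. Play $\tau_m-\tau_{m-1}$ rounds: in each, draw $c\sim\mathcal D$ and $\pi\sim p_m^h(c)$ and observe a trajectory from $M_\star(\pi,c)$. Call the oracle once on the data of this segment and let $\widehat P_m^h$ be the $h$-th layer of its answer. Then $\widehat M_m=(\widehat P_m^h)_{h\in[H]}$. Ties in all maximizations are broken arbitrarily, but measurably in contexts and data. **Theorem 6.1.** For every $\kappa>0$ there is a constant $K>0$ depending only on $\kappa$ such that, for all instances as above, with $q=H^7S^4A^3\log(|\mathcal M|/\delta)/\varepsilon^2$, the following holds for every multiple $T$ of $2H$ with $T\ge Kq$. LOLIPOP with $N=2$, $\tau_1=T/(2H)$, $\tau_2=T/H$ and the oracle $\mathsf{MLE}_{\mathcal M}$ samples $T$ trajectories, makes $2H=O(H)$ oracle calls, and, with probability at least $1-\delta$, its output $\widehat M_2$ satisfies $$\mathbb E_{c\sim\mathcal D}\Big[\big|V_{M_\star}(\pi_c,c,R)-V_{\widehat M_2}(\pi_c,c,R)\big|\Big]\le\varepsilon$$ simultaneously for all families of policies $(\pi_c)_{c\in\mathcal C}$ and all reward distributions $R$ such that for $\mathcal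 D$-almost every $c$ the total reward $\sum_h r^h$ is at most $1$ almost surely under $M_\star(\pi,c;R)$ and under $\widehat M_2(\pi,c;R)$ for every policy $\pi$. Moreover, if $\varepsilon\le1$, there is a multiple $T$ of $2H$ with $Kq\le T\le 2Kq$, so that $T=O(q)$ trajectories suffice. -/

import Mathlib

open MeasureTheory

noncomputable section

namespace Lolipop

/-- Randomized non-stationary policies: one distribution on actions per layer and state.
Layers `1, …, H` of the mathematics are `0, …, H - 1 : Fin H` here. -/
abbrev Policy (S A : Type*) [Fintype A] (H : ℕ) := Fin H → S → stdSimplex ℝ A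

/-- The transition part of a tabular contextual MDP with horizon `H`: for every layer, state, action
and context a distribution on next states, measurable in the context.  In the reward-free setting
every model of the class has reward constantly `0` and no reward is observed, so that a model is
its transition part; reward distributions come in separately, see `Reward` and `value`. -/
structure CMDP (C S A : Type*) [MeasurableSpace C] [Fintype S] (H : ℕ) where
  P : Fin H → S → A → C → stdSimplex ℝ S
  measurable_P : ∀ h s a, Measurable (P h s a)

/-- Reward distributions `R^h(s, a; c) ∈ Δ([0,1])`. -/
abbrev Reward (C S A : Type*) (H : ℕ) := Fin H → S → A → C → ProbabilityMeasure unitInterval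

/-- The reward distribution that is constantly `0`. -/
def zeroReward (C S A : Type*) (H : ℕ) : Reward C S A H :=
  fun _ _ _ _ => ⟨Measure.dirac 0, inferInstance⟩

/-- The state-action part `s^1, a^1, …, s^H, a^H` of a trajectory. -/
abbrev Traj (S A : Type*) (H : ℕ) := Fin H → S × A

/-- What the learner records in one round: context, executed policy, trajectory. -/
abbrev Round (C S A : Type*) [Fintype A] (H : ℕ) := C × Policy S A H × Traj S A H

section Model

variable {C S A : Type*} [MeasurableSpace C] [Fintype S] [Fintype A] [DecidableEq S] {H : ℕ}

/-- Probability of the trajectory `x` under model `M`, policy `π` and context `c`, when every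
trajectory starts in `s₁`. -/
def trajProb (s₁ : S) (M : CMDP C S A H) (π : Policy S A H) (c : C) (x : Traj S A H) : ℝ :=
  (∏ h : Fin H,
    if h0 : h.val = 0 then (if (x h).1 = s₁ then 1 else 0)
    else
      let g : Fin H := ⟨h.val - 1, by omega⟩
      (M.P g (x g).1 (x g).2 c).1 (x h).1) *
  ∏ h : Fin H, (π h (x h).1).1 (x h).2

variable [MeasurableSpace S] [MeasurableSpace A]

/-- The law of the trajectory (without rewards) under `M(π, c)`. -/
def trajLaw (s₁ : S) (M : CMDP C S A H) (π : Policy S A H) (c : C) : Measure (Traj S A H) :=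
  ∑ x : Traj S A H, ENNReal.ofReal (trajProb s₁ M π c x) • Measure.dirac x

/-- The law of the trajectory with rewards under `M(π, c; R)`: given the states and actions, the
rewards are independent with `r^h ∼ R^h(s^h, a^h; c)`. -/
def rewardTrajLaw (s₁ : S) (M : CMDP C S A H) (R : Reward C S A H) (π : Policy S A H) (c : C) :
    Measure (Traj S A H × (Fin H → unitInterval)) :=
  ∑ x : Traj S A H, ENNReal.ofReal (trajProb s₁ M π c x) •
    (Measure.dirac x).prod (Measure.pi fun h => (R h (x h).1 (x h).2 c : Measure unitInterval))

/-- The value `V_M(π, c, R)`: the expected total reward of `π` in `M(·; R)` under context `c`. -/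
def value (s₁ : S) (M : CMDP C S A H) (R : Reward C S A H) (π : Policy S A H) (c : C) : ℝ :=
  ∫ y, ∑ h, (y.2 h : ℝ) ∂(rewardTrajLaw s₁ M R π c)

/-- Under context `c`, whatever policy is run in `M(·; R)`, the total reward is at most `1` almost
surely (it is nonnegative anyway). -/
def BoundedReturn (s₁ : S) (M : CMDP C S A H) (R : Reward C S A H) (c : C) : Prop :=
  ∀ π : Policy S A H, ∀ᵐ y ∂(rewardTrajLaw s₁ M R π c), ∑ h, (y.2 h : ℝ) ≤ 1

/-- The law of one round: `c ∼ D`, `π ∼ p(c)`, and a trajectory from `M(π, c)`. -/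
def roundLaw (s₁ : S) (D : Measure C) (M : CMDP C S A H) (p : C → Measure (Policy S A H)) :
    Measure (Round C S A H) :=
  D.bind fun c => (p c).bind fun π => (trajLaw s₁ M π c).map fun x => (c, π, x)

end Model

/-- The likelihood of a data set under the model `M`. -/
def likelihood {C S A : Type*} [MeasurableSpace C] [Fintype S] [Fintype A] [DecidableEq S] {H : ℕ}
    (s₁ : S) (M : CMDP C S A H) {n : ℕ} (data : Fin n → Round C S A H) : ℝ :=
  ∏ i, trajProb s₁ M (data i).2.1 (data i).1 (data i).2.2

/-- The inputs of the algorithm: starting state, model class, number `N` of epochs, epoch schedule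
`0 = τ 0 < τ 1 < … < τ N`, constant `κ` of the error rate of the oracle, confidence `δ`. -/
structure Params (C S A : Type*) [MeasurableSpace C] [Fintype S] (H : ℕ) where
  s₁ : S
  𝓜 : Finset (CMDP C S A H)
  N : ℕ
  τ : ℕ → ℕ
  κ : ℝ
  δ : ℝ

/-- The error rate of maximum likelihood estimation with `n` samples at confidence `δ` for a class
of `K` models, in squared Hellinger distance; without samples it is the trivial bound `1`. -/
def mleRate (κ : ℝ) (K : ℕ) (δ : ℝ) (n : ℕ) : ℝ :=
  if n = 0 then 1 else κ * Real.log (K / δ) / n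

section Algorithm

variable {C S A : Type*} [MeasurableSpace C] [Fintype S] [Fintype A] [DecidableEq S]
  [MeasurableSpace S] [MeasurableSpace A] {H : ℕ}

/-- `ℰ_m`, computed from the length `τ (m - 1) - τ (m - 2)` of the previous segments; natural
subtraction encodes `τ (-1) = τ 0`, so that for `m = 1` the length is `0`. -/
def Params.err (p : Params C S A H) (m : ℕ) : ℝ :=
  mleRate p.κ p.𝓜.card (p.δ / (2 * (p.N : ℝ) ^ 2)) (p.τ (m - 1) - p.τ (m - 2))

def Params.γ (p : Params C S A H) (m : ℕ) : ℝ :=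
  √((H : ℝ) ^ 6 * (Fintype.card S : ℝ) ^ 4 * (Fintype.card A : ℝ) ^ 3 / p.err m)

def Params.η (p : Params C S A H) (m : ℕ) : ℝ :=
  p.γ m / (720 * Real.exp 1 * (H : ℝ) ^ 5 * (Fintype.card S : ℝ) ^ 3 * (Fintype.card A : ℝ) ^ 2)

def Params.ζ (p : Params C S A H) (m : ℕ) : ℝ :=
  p.γ m / (8 * Real.exp 1 * (H : ℝ) * ((H : ℝ) + 1) ^ 2)

/-- The estimated regret of `π` under context `c`, for the estimated model `M` and the estimated
reward `0`. -/
def Params.regHat (p : Params C S A H) (M : CMDP C S A H) (π : Policy S A H) (c : C) : ℝ :=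
  (⨆ π' : Policy S A H, value p.s₁ M (zeroReward C S A H) π' c) -
    value p.s₁ M (zeroReward C S A H) π c

/-- `SA + η_m · reg`, the denominator in the definition of trusted transitions and of the policy
cover; `prev` is the model estimated in epoch `m - 1`. -/
def Params.gap (p : Params C S A H) (m : ℕ) (prev : CMDP C S A H) (π : Policy S A H) (c : C) : ℝ :=
  (Fintype.card S : ℝ) * (Fintype.card A : ℝ) + p.η m * p.regHat prev π c

/-- Trusted transitions `(s, a, s')` at layer `h` of epoch `m`, given the trusted occupancies
`d π s` at that layer; `cur` holds the transitions estimated so far in epoch `m`.  A maximum over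
`π` is at least a number iff some `π` attains that number. -/
def Params.Trusted (p : Params C S A H) (m : ℕ) (prev cur : CMDP C S A H) (c : C) (h : Fin H)
    (d : Policy S A H → S → ℝ) (s : S) (a : A) (s' : S) : Prop :=
  ∃ π : Policy S A H,
    1 / p.ζ m ≤ d π s * (π h s).1 a / p.gap m prev π c * (cur.P h s a c).1 s'

open Classical in
/-- The trusted occupancy measure of states at layer number `k` (counted from `0`) in epoch `m`. -/
def Params.trustedOcc (p : Params C S A H) (m : ℕ) (prev cur : CMDP C S A H) (c : C) :
    (k : ℕ) → k < H → Policy S A H → S → ℝ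
  | 0, _ => fun _ s => if s = p.s₁ then 1 else 0
  | k + 1, hk =>
    let h : Fin H := ⟨k, Nat.lt_of_succ_lt hk⟩
    let d := p.trustedOcc m prev cur c k h.isLt
    fun π s => ∑ s', ∑ a',
      if p.Trusted m prev cur c h d s' a' s
      then d π s' * (π h s').1 a' * (cur.P h s' a' c).1 s else 0

/-- The trusted occupancy measure of state-action pairs at layer `h` in epoch `m`. -/
def Params.trustedOccSA (p : Params C S A H) (m : ℕ) (prev cur : CMDP C S A H) (c : C) (h : Fin H)
    (π : Policy S A H) (s : S) (a : A) : ℝ :=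
  p.trustedOcc m prev cur c h.val h.isLt π s * (π h s).1 a

/-- What the algorithm leaves open: the initial model (any), and how ties are broken in its
maximizations (in any way that is measurable in contexts and data).
* `oracle` is a maximum likelihood estimator over the model class;
* `greedy M c` is an optimal policy of the estimated model `M` under context `c`;
* `explore m h prev cur s a c` is the policy that covers `(s, a)` at layer `h` in epoch `m`. -/
structure Choices (p : Params C S A H) where
  init : CMDP C S A H
  oracle : (n : ℕ) → (Fin n → Round C S A H) → CMDP C S A H
  oracle_mem : ∀ n data, oracle n data ∈ p.𝓜
  oracle_max : ∀ n data, ∀ M ∈ p.𝓜,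
    likelihood p.s₁ M data ≤ likelihood p.s₁ (oracle n data) data
  oracle_measurable : ∀ n M, MeasurableSet {data | oracle n data = M}
  greedy : CMDP C S A H → C → Policy S A H
  greedy_max : ∀ M c π, value p.s₁ M (zeroReward C S A H) π c ≤
    value p.s₁ M (zeroReward C S A H) (greedy M c) c
  greedy_measurable : ∀ M, Measurable (greedy M)
  explore : ℕ → Fin H → CMDP C S A H → CMDP C S A H → S → A → C → Policy S A H
  explore_max : ∀ m h prev cur s a c π,
    p.trustedOccSA m prev cur c h π s a / p.gap m prev π c ≤
      p.trustedOccSA m prev cur c h (explore m h prev cur s a c) s a /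
        p.gap m prev (explore m h prev cur s a c) c
  explore_measurable : ∀ m h prev cur s a, Measurable (explore m h prev cur s a)

variable {p : Params C S A H}

open Classical in
/-- The policy cover (as a set: coinciding policies are not repeated). -/
def Choices.cover (ch : Choices p) (m : ℕ) (h : Fin H) (prev cur : CMDP C S A H) (c : C) :
    Finset (Policy S A H) :=
  insert (ch.greedy prev c)
    (Finset.univ.image fun sa : S × A => ch.explore m h prev cur sa.1 sa.2 c)

/-- The number `l > 0` with `∑_{π ∈ F} 1 / (l + g π) = 1`.  For `g ≥ 0` that vanishes somewhere on
`F` it exists and is unique, since the sum is continuous and strictly decreasing in `l`. -/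
def igwNorm {X : Type*} (F : Finset X) (g : X → ℝ) : ℝ :=
  Classical.epsilon fun l : ℝ => 0 < l ∧ ∑ π ∈ F, 1 / (l + g π) = 1

/-- The inverse gap weighting distribution on the policy cover under context `c`. -/
def Choices.policyLaw (ch : Choices p) (m : ℕ) (h : Fin H) (prev cur : CMDP C S A H) (c : C) :
    Measure (Policy S A H) :=
  let F := ch.cover m h prev cur c
  let g : Policy S A H → ℝ := fun π => p.η m * p.regHat prev π c
  ∑ π ∈ F, ENNReal.ofReal (1 / (igwNorm F g + g π)) • Measure.dirac π

/-- The state of the algorithm: the model `prev` estimated in the previous epoch, the model `cur`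
whose layers are estimated in the current epoch one after the other, the number of trajectories
sampled so far and the number of oracle calls so far. -/
structure State (C S A : Type*) [MeasurableSpace C] [Fintype S] (H : ℕ) where
  prev : CMDP C S A H
  cur : CMDP C S A H
  trajectories : ℕ
  calls : ℕ

/-- Only finitely many states are reachable, so all sets of states count as events. -/
instance : MeasurableSpace (State C S A H) := ⊤

/-- `M` with the layer `h` replaced by that of `M'`. -/
def CMDP.replaceLayer (M M' : CMDP C S A H) (h : Fin H) : CMDP C S A H where
  P := fun j => if j = h then M'.P j else M.P j
  measurable_P := fun j s a => by
    by_cases hj : j = h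
    · simpa [hj] using M'.measurable_P h s a
    · simpa [hj] using M.measurable_P j s a

/-- The segment `h` of epoch `m` from state `st`, when the true model is `M`: `τ m - τ (m - 1)`
rounds are played independently with the policy kernel of this segment, then the oracle is called
once on these rounds, and layer `h` of its answer is kept. -/
def Choices.segment (ch : Choices p) (D : Measure C) (M : CMDP C S A H) (m : ℕ) (st : State C S A H)
    (h : Fin H) : Measure (State C S A H) :=
  (Measure.pi fun _ : Fin (p.τ m - p.τ (m - 1)) =>
      roundLaw p.s₁ D M (ch.policyLaw m h st.prev st.cur)).map
    fun data =>
      { prev := st.prev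
        cur := st.cur.replaceLayer (ch.oracle _ data) h
        trajectories := st.trajectories + (p.τ m - p.τ (m - 1))
        calls := st.calls + 1 }

/-- The epoch `m` from state `st`: the model estimated last becomes the previous model, then the
segments of the layers are run in order. -/
def Choices.epoch (ch : Choices p) (D : Measure C) (M : CMDP C S A H) (m : ℕ) (st : State C S A H) :
    Measure (State C S A H) :=
  (List.finRange H).foldl (fun μ h => μ.bind fun st' => ch.segment D M m st' h)
    (Measure.dirac { st with prev := st.cur })

/-- The law of the state of the algorithm after its first `m` epochs. -/
def Choices.run (ch : Choices p) (D : Measure C) (M : CMDP C S A H) : ℕ → Measure (State C S A H)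
  | 0 => Measure.dirac { prev := ch.init, cur := ch.init, trajectories := 0, calls := 0 }
  | m + 1 => (ch.run D M m).bind (ch.epoch D M (m + 1))

/-- The reward-free objective for the output `Mhat` when `M` is the true model: for every reward
distribution (with total reward at most `1` in both models) and every family of policies, the
values are within `ε` in expectation over the context. -/
def RewardFreeObjective (s₁ : S) (D : Measure C) (M Mhat : CMDP C S A H) (ε : ℝ) : Prop :=
  ∀ (R : Reward C S A H) (π : C → Policy S A H),
    (∀ᵐ c ∂D, BoundedReturn s₁ M R c ∧ BoundedReturn s₁ Mhat R c) →
    ∫⁻ c, ENNReal.ofReal |value s₁ M R (π c) c - value s₁ Mhat R (π c) c| ∂D ≤ ENNReal.ofReal ε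

end Algorithm

/-- The schedule with two epochs `τ 1 = T / (2H)` and `τ 2 = T / H`. -/
def twoEpochs (H T : ℕ) : ℕ → ℕ
  | 0 => 0
  | 1 => T / (2 * H)
  | _ => T / H

/-- `H^7 S^4 A^3 log (K / δ) / ε^2`. -/
def sampleSize (H S A K : ℕ) (ε δ : ℝ) : ℝ :=
  (H : ℝ) ^ 7 * (S : ℝ) ^ 4 * (A : ℝ) ^ 3 * Real.log (K / δ) / ε ^ 2

end Lolipop

end

open MeasureTheory Lolipop

set_option linter.unusedSectionVars false

/-! With zero rewards every estimated regret vanishes. Hence `Params.gap` is the constant SA, each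
exploration policy maximizes a trusted occupancy outright, and inverse gap weighting is uniform on a
cover of at most SA + 1 policies. The guarantee of an epoch then holds from every starting state, so
that only the second epoch has to be analysed (`epoch_le_delta`, `le_run_succ`).

Fix a context. The trusted occupancies are those of the substochastic chain `Params.trustedKer`,
obtained from the estimate by deleting untrusted transitions. The central quantity is `Params.loss`:
the Hellinger error of a layer, weighted by the largest trusted occupancies. As long as trusted
estimates exceed the true probabilities by a factor of at most 1 + 1/H, trusted occupancies are at
most e times the true ones, so the loss is at most 2e(SA + 1) times the mean Hellinger distance of
the trajectory laws under the policies actually played (`ofReal_loss_replaceLayer_le`).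

If this domination holds at all layers that matter, a simulation argument bounds the value gap by
the loss plus the deleted mass, which is of order HS³A²/ζ (`abs_value_sub_le_of_dominated`). If it
fails, then at the first bad layer some trusted transition is overestimated; being trusted, it has
occupancy times probability at least SA/ζ, so the loss there is at least SA/(32H²ζ), and this pays
for the trivial gap 1 (`one_le_loss_of_not_dominated`). The loss involves neither rewards nor the
evaluated policies, so the bound is uniform in both.

For the statistics, the maximum likelihood estimate from N rounds satisfies E exp(N · risk) ≤ |𝓜|
(`lintegral_exp_hellingerRisk_le`). These moments multiply along the segments of an epoch, because a
segment never changes the losses of earlier layers (`lintegral_segments_exp_le`), and Markov's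
inequality bounds the sum of the layer losses by order SAH log(|𝓜|/δ)/N without a union bound over
layers. It remains to balance four error terms (`error_budget`). -/

namespace Lolipop

/-! ### Occupancies, trajectory weights and Hellinger affinity of finite-horizon chains -/

section Chain

variable {S A : Type*} [Fintype S] [Fintype A] [DecidableEq S]

/-- State occupancies of the chain with (not necessarily stochastic) kernels `g` and policy `q`. -/
noncomputable def occ (s₁ : S) (g : ℕ → S → A → S → ℝ) (q : ℕ → S → A → ℝ) : ℕ → S → ℝ
  | 0, s => if s = s₁ then 1 else 0
  | k + 1, s => ∑ s', ∑ a', occ s₁ g q k s' * q k s' a' * g k s' a' s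

/-- The weight of a trajectory of length `n + 1` in the chain with kernels `g` and policy `q`. -/
noncomputable def chainWeight (s₁ : S) (g : ℕ → S → A → S → ℝ) (q : ℕ → S → A → ℝ) :
    (n : ℕ) → (Fin (n + 1) → S × A) → ℝ
  | 0, x => (if (x 0).1 = s₁ then 1 else 0) * q 0 (x 0).1 (x 0).2
  | n + 1, x => chainWeight s₁ g q n (Fin.init x) *
      (g n (x (Fin.last n).castSucc).1 (x (Fin.last n).castSucc).2 (x (Fin.last _)).1 *
        q (n + 1) (x (Fin.last _)).1 (x (Fin.last _)).2)

/-- The kernels whose chain weights are the geometric means of those of `g` and `g'`. -/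
noncomputable def affKer (g g' : ℕ → S → A → S → ℝ) : ℕ → S → A → S → ℝ :=
  fun k s a s' => √(g k s a s' * g' k s a s')

variable {s₁ : S} {g g' : ℕ → S → A → S → ℝ} {q : ℕ → S → A → ℝ}

lemma occ_nonneg (hg : ∀ k s a s', 0 ≤ g k s a s') (hq : ∀ k s a, 0 ≤ q k s a) (k : ℕ) (s : S) :
    0 ≤ occ s₁ g q k s := by
  induction k generalizing s with
  | zero => simp only [occ]; split_ifs <;> norm_num
  | succ k ih =>
    exact Finset.sum_nonneg fun s' _ => Finset.sum_nonneg fun a' _ =>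
      mul_nonneg (mul_nonneg (ih s') (hq _ _ _)) (hg _ _ _ _)

lemma occ_congr {g g' : ℕ → S → A → S → ℝ} {q q' : ℕ → S → A → ℝ} (k : ℕ)
    (h : ∀ j < k, g j = g' j) (hq : ∀ j < k, q j = q' j) :
    occ s₁ g q k = occ s₁ g' q' k := by
  induction k with
  | zero => rfl
  | succ k ih =>
    funext s
    simp only [occ]
    rw [ih (fun j hj => h j (by omega)) (fun j hj => hq j (by omega)), h k (by omega),
      hq k (by omega)]

lemma occ_le_pow_mul (hg : ∀ k s a s', 0 ≤ g k s a s') (hg' : ∀ k s a s', 0 ≤ g' k s a s')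
    (hq : ∀ k s a, 0 ≤ q k s a) {r : ℝ} (hr : 0 ≤ r) (k : ℕ)
    (h : ∀ j < k, ∀ s a s', g j s a s' ≤ r * g' j s a s') (s : S) :
    occ s₁ g q k s ≤ r ^ k * occ s₁ g' q k s := by
  induction k generalizing s with
  | zero => simp [occ]
  | succ k ih =>
    simp only [occ, Finset.mul_sum]
    refine Finset.sum_le_sum fun s' _ => Finset.sum_le_sum fun a' _ => ?_
    calc occ s₁ g q k s' * q k s' a' * g k s' a' s
        ≤ (r ^ k * occ s₁ g' q k s') * q k s' a' * (r * g' k s' a' s) := by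
          have h1 := ih (fun j hj => h j (by omega)) s'
          have h2 := h k (by omega) s' a' s
          have h3 := occ_nonneg (s₁ := s₁) hg' hq k s'
          have := hq k s' a'
          have := hg k s' a' s
          gcongr
      _ = _ := by ring

lemma sum_occ_succ (k : ℕ) :
    ∑ s, occ s₁ g q (k + 1) s = ∑ s, ∑ a, occ s₁ g q k s * q k s a * ∑ s', g k s a s' := by
  simp only [occ, Finset.mul_sum]
  rw [Finset.sum_comm]
  exact Finset.sum_congr rfl fun s _ => Finset.sum_comm

lemma sum_occ_mul_policy (hq1 : ∀ k s, ∑ a, q k s a = 1) (k : ℕ) :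
    ∑ s, ∑ a, occ s₁ g q k s * q k s a = ∑ s, occ s₁ g q k s := by
  simp [← Finset.mul_sum, hq1]

lemma sum_occ_eq_one (hg1 : ∀ k s a, ∑ s', g k s a s' = 1) (hq1 : ∀ k s, ∑ a, q k s a = 1)
    (k : ℕ) : ∑ s, occ s₁ g q k s = 1 := by
  induction k with
  | zero => simp [occ]
  | succ k ih => simp [sum_occ_succ, hg1, sum_occ_mul_policy hq1, ih]

lemma sum_occ_antitone (hg : ∀ k s a s', 0 ≤ g k s a s') (hg1 : ∀ k s a, ∑ s', g k s a s' ≤ 1)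
    (hq : ∀ k s a, 0 ≤ q k s a) (hq1 : ∀ k s, ∑ a, q k s a = 1) :
    Antitone fun k => ∑ s, occ s₁ g q k s := by
  refine antitone_nat_of_succ_le fun k => ?_
  rw [sum_occ_succ, ← sum_occ_mul_policy hq1 k]
  refine Finset.sum_le_sum fun s _ => Finset.sum_le_sum fun a _ => ?_
  exact mul_le_of_le_one_right (mul_nonneg (occ_nonneg hg hq k s) (hq _ _ _)) (hg1 _ _ _)

lemma sum_occ_le_one (hg : ∀ k s a s', 0 ≤ g k s a s') (hg1 : ∀ k s a, ∑ s', g k s a s' ≤ 1)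
    (hq : ∀ k s a, 0 ≤ q k s a) (hq1 : ∀ k s, ∑ a, q k s a = 1) (k : ℕ) :
    ∑ s, occ s₁ g q k s ≤ 1 :=
  (sum_occ_antitone hg hg1 hq hq1 (Nat.zero_le k)).trans (by simp [occ])

lemma affKer_nonneg (k : ℕ) (s : S) (a : A) (s' : S) : 0 ≤ affKer g g' k s a s' :=
  Real.sqrt_nonneg _

lemma sum_affKer_le_one (hg : ∀ k s a s', 0 ≤ g k s a s') (hg' : ∀ k s a s', 0 ≤ g' k s a s')
    (hg1 : ∀ k s a, ∑ s', g k s a s' = 1) (hg1' : ∀ k s a, ∑ s', g' k s a s' = 1)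
    (k : ℕ) (s : S) (a : A) : ∑ s', affKer g g' k s a s' ≤ 1 := by
  have h : ∀ s', affKer g g' k s a s' ≤ (g k s a s' + g' k s a s') / 2 := fun s' => by
    have h1 := Real.sq_sqrt (hg k s a s')
    have h2 := Real.sq_sqrt (hg' k s a s')
    rw [affKer, Real.sqrt_mul (hg k s a s')]
    nlinarith [sq_nonneg (√(g k s a s') - √(g' k s a s'))]
  calc ∑ s', affKer g g' k s a s' ≤ ∑ s', (g k s a s' + g' k s a s') / 2 :=
        Finset.sum_le_sum fun s' _ => h s'
    _ = 1 := by rw [← Finset.sum_div, Finset.sum_add_distrib, hg1, hg1']; norm_num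

/-- Hellinger affinity can only grow under marginalization to the state at layer k: one application
of Cauchy–Schwarz per step. -/
lemma occ_affKer_le (hg : ∀ k s a s', 0 ≤ g k s a s') (hg' : ∀ k s a s', 0 ≤ g' k s a s')
    (hq : ∀ k s a, 0 ≤ q k s a) (k : ℕ) (s : S) :
    occ s₁ (affKer g g') q k s ≤ √(occ s₁ g q k s) * √(occ s₁ g' q k s) := by
  induction k generalizing s with
  | zero => simp only [occ]; split_ifs <;> simp
  | succ k ih =>
    simp only [occ, ← Fintype.sum_prod_type']
    have h0 : ∀ {f : ℕ → S → A → S → ℝ}, (∀ k s a s', 0 ≤ f k s a s') → ∀ y : S × A,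
        0 ≤ occ s₁ f q k y.1 * q k y.1 y.2 * f k y.1 y.2 s := fun hf y =>
      mul_nonneg (mul_nonneg (occ_nonneg hf hq _ _) (hq _ _ _)) (hf _ _ _ _)
    refine le_trans (Finset.sum_le_sum fun y _ => ?_)
      (Real.sum_sqrt_mul_sqrt_le Finset.univ (h0 hg) (h0 hg'))
    have h1 : occ s₁ g q k y.1 * q k y.1 y.2 * g k y.1 y.2 s *
        (occ s₁ g' q k y.1 * q k y.1 y.2 * g' k y.1 y.2 s) =
        (q k y.1 y.2) ^ 2 * (occ s₁ g q k y.1 * occ s₁ g' q k y.1 *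
          (g k y.1 y.2 s * g' k y.1 y.2 s)) := by ring
    rw [← Real.sqrt_mul (h0 hg y), h1, Real.sqrt_mul (sq_nonneg _), Real.sqrt_sq (hq _ _ _),
      Real.sqrt_mul (mul_nonneg (occ_nonneg hg hq _ _) (occ_nonneg hg' hq _ _)),
      Real.sqrt_mul (occ_nonneg hg hq _ _)]
    calc _ ≤ (√(occ s₁ g q k y.1) * √(occ s₁ g' q k y.1)) * q k y.1 y.2 * affKer g g' k y.1 y.2 s :=
          mul_le_mul_of_nonneg_right (mul_le_mul_of_nonneg_right (ih _) (hq _ _ _))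
            (affKer_nonneg _ _ _ _)
      _ = _ := by rw [affKer]; ring

/-- The squared Hellinger distance of the kernels at layer `k`, averaged over the occupancy of the
first chain, is controlled by that of the whole chains. -/
lemma sum_occ_mul_hellinger_le (hg : ∀ k s a s', 0 ≤ g k s a s')
    (hg' : ∀ k s a s', 0 ≤ g' k s a s')
    (hg1 : ∀ k s a, ∑ s', g k s a s' = 1) (hg1' : ∀ k s a, ∑ s', g' k s a s' = 1)
    (hq : ∀ k s a, 0 ≤ q k s a) (hq1 : ∀ k s, ∑ a, q k s a = 1) {k n : ℕ} (hkn : k < n) :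
    ∑ s, ∑ a, occ s₁ g q k s * q k s a * (1 - ∑ s', affKer g g' k s a s') ≤
      2 * (1 - ∑ s, occ s₁ (affKer g g') q n s) := by
  -- The affinity chain is substochastic, so after layer k it can only lose further mass.
  have h1 : ∑ s, occ s₁ (affKer g g') q n s ≤
      ∑ s, ∑ a, occ s₁ (affKer g g') q k s * q k s a * ∑ s', affKer g g' k s a s' := by
    rw [← sum_occ_succ]
    exact sum_occ_antitone affKer_nonneg (sum_affKer_le_one hg hg' hg1 hg1') hq hq1 hkn
  -- Writing 1 as the average of the two total masses turns the claim into a pointwise inequality in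
  -- (s, a).
  have h2 : (1 : ℝ) = ∑ s, ∑ a, (occ s₁ g q k s * q k s a + occ s₁ g' q k s * q k s a) / 2 := by
    simp_rw [← Finset.sum_div, Finset.sum_add_distrib, sum_occ_mul_policy hq1,
      sum_occ_eq_one hg1 hq1, sum_occ_eq_one hg1' hq1]
    norm_num
  suffices h : ∑ s, ∑ a, occ s₁ g q k s * q k s a * (1 - ∑ s', affKer g g' k s a s') ≤
      ∑ s, ∑ a, (2 * ((occ s₁ g q k s * q k s a + occ s₁ g' q k s * q k s a) / 2) -
        2 * (occ s₁ (affKer g g') q k s * q k s a * ∑ s', affKer g g' k s a s')) by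
    have hsum : ∀ u v : S → A → ℝ, ∑ s, ∑ a, (2 * u s a - 2 * v s a) =
        2 * ∑ s, ∑ a, u s a - 2 * ∑ s, ∑ a, v s a := fun u v => by
      simp only [Finset.sum_sub_distrib, Finset.mul_sum]
    rw [hsum, ← h2] at h
    linarith
  refine Finset.sum_le_sum fun s _ => Finset.sum_le_sum fun a _ => ?_
  have hb1 := sum_affKer_le_one hg hg' hg1 hg1' k s a
  have hb0 : 0 ≤ ∑ s', affKer g g' k s a s' := Finset.sum_nonneg fun s' _ => affKer_nonneg _ _ _ _
  set b := ∑ s', affKer g g' k s a s'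
  have ha := occ_affKer_le (s₁ := s₁) hg hg' hq k s
  have hx := Real.sq_sqrt (occ_nonneg (s₁ := s₁) hg hq k s)
  have hy := Real.sq_sqrt (occ_nonneg (s₁ := s₁) hg' hq k s)
  set x := √(occ s₁ g q k s)
  set y := √(occ s₁ g' q k s)
  rw [← hx, ← hy]
  have hq0 := hq k s a
  -- After bounding the affinity by xy, the difference of the two sides is b(x - y)² + (1 - b)y².
  have key : x ^ 2 * (1 - b) ≤ x ^ 2 + y ^ 2 - 2 * (occ s₁ (affKer g g') q k s * b) := by
    have := mul_le_mul_of_nonneg_right ha hb0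
    nlinarith [mul_nonneg hb0 (sq_nonneg (x - y)), mul_nonneg (sub_nonneg.2 hb1) (sq_nonneg y)]
  nlinarith [mul_le_mul_of_nonneg_right key hq0]

lemma chainWeight_nonneg (hg : ∀ k s a s', 0 ≤ g k s a s') (hq : ∀ k s a, 0 ≤ q k s a) (n : ℕ)
    (x : Fin (n + 1) → S × A) : 0 ≤ chainWeight s₁ g q n x := by
  induction n with
  | zero => exact mul_nonneg (by split_ifs <;> norm_num) (hq _ _ _)
  | succ n ih => exact mul_nonneg (ih _) (mul_nonneg (hg _ _ _ _) (hq _ _ _))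

lemma chainWeight_mono (hg : ∀ k s a s', 0 ≤ g k s a s') (hg' : ∀ k s a s', 0 ≤ g' k s a s')
    (hq : ∀ k s a, 0 ≤ q k s a) (n : ℕ) (h : ∀ j < n, ∀ s a s', g j s a s' ≤ g' j s a s')
    (x : Fin (n + 1) → S × A) : chainWeight s₁ g q n x ≤ chainWeight s₁ g' q n x := by
  induction n with
  | zero => exact le_rfl
  | succ n ih =>
    exact mul_le_mul (ih (fun j hj => h j (by omega)) _)
      (mul_le_mul_of_nonneg_right (h n (by omega) _ _ _) (hq _ _ _))
      (mul_nonneg (hg _ _ _ _) (hq _ _ _)) (chainWeight_nonneg hg' hq _ _)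

lemma chainWeight_ne_zero (n : ℕ) (h : ∀ j < n, ∀ s a s', g j s a s' ≠ 0 → g' j s a s' ≠ 0)
    (x : Fin (n + 1) → S × A) (hx : chainWeight s₁ g q n x ≠ 0) :
    chainWeight s₁ g' q n x ≠ 0 := by
  induction n with
  | zero => exact hx
  | succ n ih =>
    simp only [chainWeight] at hx ⊢
    simp only [mul_ne_zero_iff] at hx ⊢
    exact ⟨ih (fun j hj => h j (by omega)) _ hx.1, h n (by omega) _ _ _ hx.2.1, hx.2.2⟩

/-- Both chains share the policy, so its factors come out of the square root unchanged and only the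
kernels are averaged geometrically. -/
lemma sqrt_chainWeight_mul (hg : ∀ k s a s', 0 ≤ g k s a s') (hg' : ∀ k s a s', 0 ≤ g' k s a s')
    (hq : ∀ k s a, 0 ≤ q k s a) (n : ℕ) (x : Fin (n + 1) → S × A) :
    √(chainWeight s₁ g q n x * chainWeight s₁ g' q n x) = chainWeight s₁ (affKer g g') q n x := by
  induction n with
  | zero =>
    simp only [chainWeight]
    split_ifs
    · simp only [one_mul]; exact Real.sqrt_mul_self (hq _ _ _)
    · simp
  | succ n ih =>
    simp only [chainWeight]
    rw [← ih, affKer, mul_mul_mul_comm, mul_mul_mul_comm (g n _ _ _),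
      Real.sqrt_mul (mul_nonneg (chainWeight_nonneg hg hq _ _) (chainWeight_nonneg hg' hq _ _)),
      Real.sqrt_mul (mul_nonneg (hg _ _ _ _) (hg' _ _ _ _)), Real.sqrt_mul_self (hq _ _ _)]

lemma sum_snoc {X : Type*} [Fintype X] {n : ℕ} (f : (Fin (n + 1) → X) → ℝ) :
    ∑ x, f x = ∑ x : Fin n → X, ∑ y : X, f (Fin.snoc x y) := by
  rw [← (Fin.snocEquiv fun _ : Fin (n + 1) => X).sum_comp, Fintype.sum_prod_type, Finset.sum_comm]
  rfl

lemma chainWeight_snoc (n : ℕ) (x : Fin (n + 1) → S × A) (y : S × A) :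
    chainWeight s₁ g q (n + 1) (Fin.snoc x y) = chainWeight s₁ g q n x *
      (g n (x (Fin.last n)).1 (x (Fin.last n)).2 y.1 * q (n + 1) y.1 y.2) := by
  simp only [chainWeight, Fin.init_snoc, Fin.snoc_castSucc, Fin.snoc_last]

lemma sum_chainWeight_mul (n : ℕ) (φ : S → A → ℝ) :
    ∑ x : Fin (n + 1) → S × A, chainWeight s₁ g q n x * φ (x (Fin.last n)).1 (x (Fin.last n)).2 =
      ∑ s, ∑ a, occ s₁ g q n s * q n s a * φ s a := by
  induction n generalizing φ with
  | zero =>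
    rw [← (Equiv.funUnique (Fin 1) (S × A)).symm.sum_comp, Fintype.sum_prod_type]
    rfl
  | succ n ih =>
    rw [sum_snoc]
    simp only [chainWeight_snoc, Fin.snoc_last, mul_assoc]
    simp only [← Finset.mul_sum]
    rw [ih fun s a => ∑ y : S × A, g n s a y.1 * (q (n + 1) y.1 y.2 * φ y.1 y.2)]
    simp only [occ, Fintype.sum_prod_type, Finset.mul_sum, Finset.sum_mul]
    rw [← Fintype.sum_prod_type' (f := fun s a => ∑ s', ∑ a', occ s₁ g q n s * q n s a *
      (g n s a s' * (q (n + 1) s' a' * φ s' a')))]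
    rw [Finset.sum_comm]
    refine Finset.sum_congr rfl fun s _ => ?_
    rw [Finset.sum_comm]
    refine Finset.sum_congr rfl fun a _ => ?_
    rw [Fintype.sum_prod_type]
    refine Finset.sum_congr rfl fun s' _ => Finset.sum_congr rfl fun a' _ => ?_
    ring

lemma sum_chainWeight (hq1 : ∀ k s, ∑ a, q k s a = 1) (n : ℕ) :
    ∑ x : Fin (n + 1) → S × A, chainWeight s₁ g q n x = ∑ s, occ s₁ g q n s := by
  have := sum_chainWeight_mul (s₁ := s₁) (g := g) (q := q) n fun _ _ => 1
  simp only [mul_one] at this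
  rw [this, sum_occ_mul_policy hq1]

/-- Simulation lemma, from w'g' - wg = (w' - w)g' + w(g' - g): the stochastic kernel g' carries the
old error along without increasing its sum, and the new error is weighted by the occupancy of g
alone. Mass conservation of g is not needed, so g may be a truncated chain. -/
lemma sum_abs_chainWeight_sub_le (hg : ∀ k s a s', 0 ≤ g k s a s')
    (hg' : ∀ k s a s', 0 ≤ g' k s a s') (hg1' : ∀ k s a, ∑ s', g' k s a s' = 1)
    (hq : ∀ k s a, 0 ≤ q k s a) (hq1 : ∀ k s, ∑ a, q k s a = 1) (n : ℕ) :
    ∑ x : Fin (n + 1) → S × A, |chainWeight s₁ g' q n x - chainWeight s₁ g q n x| ≤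
      ∑ k ∈ Finset.range n, ∑ s, ∑ a, occ s₁ g q k s * q k s a * ∑ s', |g' k s a s' - g k s a s'| := by
  induction n with
  | zero => simp [chainWeight]
  | succ n ih =>
    rw [sum_snoc, Finset.sum_range_succ]
    simp only [chainWeight_snoc]
    have hstep : ∀ (x : Fin (n + 1) → S × A), ∑ y : S × A, |chainWeight s₁ g' q n x *
          (g' n (x (Fin.last n)).1 (x (Fin.last n)).2 y.1 * q (n + 1) y.1 y.2) -
        chainWeight s₁ g q n x *
          (g n (x (Fin.last n)).1 (x (Fin.last n)).2 y.1 * q (n + 1) y.1 y.2)| ≤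
        |chainWeight s₁ g' q n x - chainWeight s₁ g q n x| + chainWeight s₁ g q n x *
          ∑ s', |g' n (x (Fin.last n)).1 (x (Fin.last n)).2 s' -
            g n (x (Fin.last n)).1 (x (Fin.last n)).2 s'| := by
      intro x
      set w := chainWeight s₁ g q n x with hw
      set w' := chainWeight s₁ g' q n x
      have hw0 : 0 ≤ w := chainWeight_nonneg hg hq n x
      set s := (x (Fin.last n)).1
      set a := (x (Fin.last n)).2
      have h1 : ∀ y : S × A, |w' * (g' n s a y.1 * q (n + 1) y.1 y.2) -
          w * (g n s a y.1 * q (n + 1) y.1 y.2)| ≤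
          (|w' - w| * g' n s a y.1 + w * |g' n s a y.1 - g n s a y.1|) * q (n + 1) y.1 y.2 := by
        intro y
        have : w' * (g' n s a y.1 * q (n + 1) y.1 y.2) - w * (g n s a y.1 * q (n + 1) y.1 y.2) =
          ((w' - w) * g' n s a y.1 + w * (g' n s a y.1 - g n s a y.1)) * q (n + 1) y.1 y.2 := by
          ring
        rw [this, abs_mul, abs_of_nonneg (hq _ _ _)]
        refine mul_le_mul_of_nonneg_right ((abs_add_le _ _).trans ?_) (hq _ _ _)
        rw [abs_mul, abs_mul, abs_of_nonneg (hg' _ _ _ _), abs_of_nonneg hw0]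
      refine (Finset.sum_le_sum fun y _ => h1 y).trans (le_of_eq ?_)
      rw [Fintype.sum_prod_type]
      simp only [← Finset.mul_sum, hq1, mul_one, Finset.sum_add_distrib, hg1']
    refine (Finset.sum_le_sum fun x _ => hstep x).trans ?_
    rw [Finset.sum_add_distrib, sum_chainWeight_mul n fun s a => ∑ s', |g' n s a s' - g n s a s'|]
    gcongr

/-- Comparison of the expectations of a function that is at most `1` on the supports of the chains
`g'` and `g''`, through kernels `g ≤ g''` dominated by `g'`. -/
lemma abs_sum_chainWeight_mul_sub_le {g'' : ℕ → S → A → S → ℝ} (hg : ∀ k s a s', 0 ≤ g k s a s')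
    (hg' : ∀ k s a s', 0 ≤ g' k s a s') (hg'' : ∀ k s a s', 0 ≤ g'' k s a s')
    (hg1' : ∀ k s a, ∑ s', g' k s a s' = 1) (hg1'' : ∀ k s a, ∑ s', g'' k s a s' = 1)
    (hq : ∀ k s a, 0 ≤ q k s a) (hq1 : ∀ k s, ∑ a, q k s a = 1) (n : ℕ)
    (hle : ∀ j < n, ∀ s a s', g j s a s' ≤ g'' j s a s')
    (hne : ∀ j < n, ∀ s a s', g j s a s' ≠ 0 → g' j s a s' ≠ 0)
    (r : (Fin (n + 1) → S × A) → ℝ) (hr0 : ∀ x, 0 ≤ r x)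
    (hr' : ∀ x, chainWeight s₁ g' q n x ≠ 0 → r x ≤ 1)
    (hr'' : ∀ x, chainWeight s₁ g'' q n x ≠ 0 → r x ≤ 1) :
    |∑ x, chainWeight s₁ g' q n x * r x - ∑ x, chainWeight s₁ g'' q n x * r x| ≤
      2 * ∑ k ∈ Finset.range n, ∑ s, ∑ a,
        occ s₁ g q k s * q k s a * ∑ s', |g' k s a s' - g k s a s'| := by
  have hE := sum_abs_chainWeight_sub_le (s₁ := s₁) hg hg' hg1' hq hq1 n
  set E := ∑ k ∈ Finset.range n, ∑ s, ∑ a,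
        occ s₁ g q k s * q k s a * ∑ s', |g' k s a s' - g k s a s'|
  have h1 : |∑ x, chainWeight s₁ g' q n x * r x - ∑ x, chainWeight s₁ g q n x * r x| ≤ E := by
    rw [← Finset.sum_sub_distrib]
    refine (Finset.abs_sum_le_sum_abs _ _).trans ((Finset.sum_le_sum fun x _ => ?_).trans hE)
    rw [← sub_mul, abs_mul, abs_of_nonneg (hr0 x)]
    -- Off the support of g' the bound on r may fail, but there g has weight zero as well.
    by_cases h0 : chainWeight s₁ g' q n x = 0
    · have : chainWeight s₁ g q n x = 0 := by
        by_contra hc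
        exact chainWeight_ne_zero n hne x hc h0
      simp [h0, this]
    · exact mul_le_of_le_one_right (abs_nonneg _) (hr' x h0)
  have hmono := chainWeight_mono (s₁ := s₁) hg hg'' hq n hle
  -- Since g lies below g'', only the total missing mass matters. As g' and g'' both have mass one,
  -- it can be computed with g' in place of g''.
  have h2 : ∑ x, chainWeight s₁ g'' q n x * r x - ∑ x, chainWeight s₁ g q n x * r x ≤ E := by
    rw [← Finset.sum_sub_distrib]
    calc _ ≤ ∑ x, (chainWeight s₁ g'' q n x - chainWeight s₁ g q n x) := by
          refine Finset.sum_le_sum fun x _ => ?_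
          rw [← sub_mul]
          by_cases h0 : chainWeight s₁ g'' q n x = 0
          · have := chainWeight_nonneg (s₁ := s₁) hg hq n x
            have h3 : chainWeight s₁ g q n x = 0 := le_antisymm (h0 ▸ hmono x) this
            simp [h0, h3]
          · exact mul_le_of_le_one_right (sub_nonneg.2 (hmono x)) (hr'' x h0)
      _ = ∑ x, (chainWeight s₁ g' q n x - chainWeight s₁ g q n x) := by
          simp only [Finset.sum_sub_distrib, sum_chainWeight hq1, sum_occ_eq_one hg1' hq1,
            sum_occ_eq_one hg1'' hq1]
      _ ≤ E := (Finset.sum_le_sum fun x _ => le_abs_self _).trans hE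
  have h3 : 0 ≤ ∑ x, chainWeight s₁ g'' q n x * r x - ∑ x, chainWeight s₁ g q n x * r x := by
    rw [← Finset.sum_sub_distrib]
    exact Finset.sum_nonneg fun x _ => by
      rw [← sub_mul]; exact mul_nonneg (sub_nonneg.2 (hmono x)) (hr0 x)
  rw [abs_le] at h1 ⊢
  constructor <;> linarith [h1.1, h1.2]

end Chain

/-! ### Policies and models as chains indexed by natural numbers -/

section Kernels

variable {C S A : Type*} [MeasurableSpace C] [Fintype S] [Fintype A] [DecidableEq S] {n : ℕ}

/-- A policy, with its layers extended to `ℕ`. -/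
noncomputable def polKer (π : Policy S A (n + 1)) : ℕ → S → A → ℝ :=
  fun k s a => (π (Fin.ofNat (n + 1) k) s).1 a

/-- The transition kernels of a model under a context, with layers extended to `ℕ`. -/
noncomputable def modelKer (M : CMDP C S A (n + 1)) (c : C) : ℕ → S → A → S → ℝ :=
  fun k s a s' => (M.P (Fin.ofNat (n + 1) k) s a c).1 s'

/-- Indices past the horizon wrap around, which keeps the extended kernels stochastic at every
index; inside the horizon nothing changes. -/
lemma Fin.ofNat_eq_mk {k : ℕ} (hk : k < n + 1) : Fin.ofNat (n + 1) k = ⟨k, hk⟩ :=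
  Fin.ext (Nat.mod_eq_of_lt hk)

lemma polKer_nonneg (π : Policy S A (n + 1)) (k : ℕ) (s : S) (a : A) : 0 ≤ polKer π k s a :=
  (π _ s).2.1 a

lemma sum_polKer (π : Policy S A (n + 1)) (k : ℕ) (s : S) : ∑ a, polKer π k s a = 1 :=
  (π _ s).2.2

lemma modelKer_nonneg (M : CMDP C S A (n + 1)) (c : C) (k : ℕ) (s : S) (a : A) (s' : S) :
    0 ≤ modelKer M c k s a s' :=
  (M.P _ s a c).2.1 s'

lemma sum_modelKer (M : CMDP C S A (n + 1)) (c : C) (k : ℕ) (s : S) (a : A) :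
    ∑ s', modelKer M c k s a s' = 1 :=
  (M.P _ s a c).2.2

lemma chainWeight_eq_prod (s₁ : S) (g : ℕ → S → A → S → ℝ) (q : ℕ → S → A → ℝ) (m : ℕ)
    (x : Fin (m + 1) → S × A) :
    chainWeight s₁ g q m x = (∏ h : Fin (m + 1),
      if h0 : h.val = 0 then (if (x h).1 = s₁ then 1 else 0)
      else g (h.val - 1) (x ⟨h.val - 1, by omega⟩).1 (x ⟨h.val - 1, by omega⟩).2 (x h).1) *
      ∏ h : Fin (m + 1), q h.val (x h).1 (x h).2 := by
  induction m with
  | zero => simp [chainWeight]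
  | succ m ih =>
    rw [Fin.prod_univ_castSucc (n := m + 1), Fin.prod_univ_castSucc (n := m + 1), chainWeight, ih,
      mul_mul_mul_comm]
    simp [Fin.init]
    exact Or.inl rfl

lemma trajProb_eq_chainWeight (s₁ : S) (M : CMDP C S A (n + 1)) (π : Policy S A (n + 1)) (c : C)
    (x : Traj S A (n + 1)) :
    trajProb s₁ M π c x = chainWeight s₁ (modelKer M c) (polKer π) n x := by
  rw [chainWeight_eq_prod, trajProb]
  congr 1
  · refine Finset.prod_congr rfl fun h _ => ?_
    split_ifs
    · rfl
    · rfl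
    · simp only [modelKer]
      rw [Fin.ofNat_eq_mk (by omega)]
  · refine Finset.prod_congr rfl fun h _ => ?_
    simp only [polKer]
    rw [Fin.ofNat_eq_mk h.isLt]

lemma trajProb_nonneg {H : ℕ} (s₁ : S) (M : CMDP C S A H) (π : Policy S A H) (c : C)
    (x : Traj S A H) : 0 ≤ trajProb s₁ M π c x := by
  refine mul_nonneg (Finset.prod_nonneg fun h _ => ?_)
    (Finset.prod_nonneg fun h _ => (π h _).2.1 _)
  split_ifs
  · exact zero_le_one
  · exact le_rfl
  · exact (M.P _ _ _ c).2.1 _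

lemma sum_trajProb (s₁ : S) (M : CMDP C S A (n + 1)) (π : Policy S A (n + 1)) (c : C) :
    ∑ x, trajProb s₁ M π c x = 1 := by
  simp only [trajProb_eq_chainWeight]
  rw [sum_chainWeight (sum_polKer π), sum_occ_eq_one (sum_modelKer M c) (sum_polKer π)]

end Kernels

/-! ### Values as weighted sums of mean returns over trajectories -/

section Value

variable {C S A : Type*} [MeasurableSpace C] [Fintype S] [Fintype A] [DecidableEq S]
  [MeasurableSpace S] [MeasurableSpace A] {H : ℕ}

/-- The expected total reward along a trajectory. -/
noncomputable def meanReturn (R : Reward C S A H) (c : C) (x : Traj S A H) : ℝ :=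
  ∑ h, ∫ u : unitInterval, (u : ℝ) ∂(R h (x h).1 (x h).2 c : Measure unitInterval)

lemma meanReturn_nonneg (R : Reward C S A H) (c : C) (x : Traj S A H) : 0 ≤ meanReturn R c x :=
  Finset.sum_nonneg fun _ _ => integral_nonneg fun u => u.2.1

lemma measurable_return :
    Measurable fun y : Traj S A H × (Fin H → unitInterval) => ∑ h, (y.2 h : ℝ) :=
  Finset.measurable_sum _ fun h _ =>
    measurable_subtype_coe.comp ((measurable_pi_apply h).comp measurable_snd)

lemma integrable_return (μ : Measure (Traj S A H × (Fin H → unitInterval))) [IsFiniteMeasure μ] :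
    Integrable (fun y : Traj S A H × (Fin H → unitInterval) => ∑ h, (y.2 h : ℝ)) μ := by
  refine Integrable.of_bound measurable_return.aestronglyMeasurable (H : ℝ)
    (Filter.Eventually.of_forall fun y => ?_)
  rw [Real.norm_eq_abs, abs_of_nonneg (Finset.sum_nonneg fun h _ => (y.2 h).2.1)]
  exact (Finset.sum_le_sum fun h _ => (y.2 h).2.2).trans (by simp)

lemma integral_return (R : Reward C S A H) (c : C) (x : Traj S A H) :
    ∫ y : Traj S A H × (Fin H → unitInterval), ∑ h, (y.2 h : ℝ) ∂((Measure.dirac x).prod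
      (Measure.pi fun h => (R h (x h).1 (x h).2 c : Measure unitInterval))) =
      meanReturn R c x := by
  rw [Measure.dirac_prod, integral_map (measurable_prodMk_left).aemeasurable
    measurable_return.aestronglyMeasurable, integral_finsetSum]
  · refine Finset.sum_congr rfl fun h _ => ?_
    have hp := measurePreserving_eval
      (fun h => (R h (x h).1 (x h).2 c : Measure unitInterval)) h
    rw [← hp.map_eq, integral_map hp.measurable.aemeasurable
      measurable_subtype_coe.aestronglyMeasurable]
  · intro h _
    refine Integrable.of_bound (measurable_subtype_coe.comp
      (measurable_pi_apply h)).aestronglyMeasurable 1 (Filter.Eventually.of_forall fun y => ?_)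
    rw [Real.norm_eq_abs, abs_of_nonneg (y h).2.1]
    exact (y h).2.2

lemma value_eq_sum (s₁ : S) (M : CMDP C S A H) (R : Reward C S A H) (π : Policy S A H) (c : C) :
    value s₁ M R π c = ∑ x, trajProb s₁ M π c x * meanReturn R c x := by
  rw [value, rewardTrajLaw, integral_finsetSum_measure fun x _ =>
    (integrable_return _).smul_measure ENNReal.ofReal_ne_top]
  refine Finset.sum_congr rfl fun x _ => ?_
  rw [integral_smul_measure, integral_return, ENNReal.toReal_ofReal (trajProb_nonneg _ _ _ _ _),
    smul_eq_mul]

lemma value_zeroReward (s₁ : S) (M : CMDP C S A H) (π : Policy S A H) (c : C) :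
    value s₁ M (zeroReward C S A H) π c = 0 := by
  rw [value_eq_sum]
  refine Finset.sum_eq_zero fun x _ => ?_
  simp [meanReturn, zeroReward, integral_dirac]

/-- An almost sure bound for a finite mixture holds under every component of positive weight;
integrating it over the rewards gives the bound on the mean. -/
lemma BoundedReturn.meanReturn_le_one {s₁ : S} {M : CMDP C S A H} {R : Reward C S A H} {c : C}
    (h : BoundedReturn s₁ M R c) (π : Policy S A H) (x : Traj S A H)
    (hx : trajProb s₁ M π c x ≠ 0) : meanReturn R c x ≤ 1 := by
  have h1 := h π
  rw [rewardTrajLaw, ← Measure.sum_fintype, Measure.ae_sum_iff] at h1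
  have h2 := h1 x
  rw [Measure.ae_ennreal_smul_measure_iff (by
    have := (trajProb_nonneg s₁ M π c x).lt_of_ne' hx
    simpa using this)] at h2
  rw [← integral_return R c x]
  calc _ ≤ ∫ y, (1 : ℝ) ∂((Measure.dirac x).prod
      (Measure.pi fun h => (R h (x h).1 (x h).2 c : Measure unitInterval))) :=
        integral_mono_ae (integrable_return _) (integrable_const _) h2
    _ = 1 := by simp

lemma value_nonneg (s₁ : S) (M : CMDP C S A H) (R : Reward C S A H) (π : Policy S A H) (c : C) :
    0 ≤ value s₁ M R π c := by
  rw [value_eq_sum]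
  exact Finset.sum_nonneg fun x _ => mul_nonneg (trajProb_nonneg _ _ _ _ _) (meanReturn_nonneg _ _ _)

lemma BoundedReturn.value_le_one {n : ℕ} {s₁ : S} {M : CMDP C S A (n + 1)}
    {R : Reward C S A (n + 1)} {c : C} (h : BoundedReturn s₁ M R c) (π : Policy S A (n + 1)) :
    value s₁ M R π c ≤ 1 := by
  rw [value_eq_sum, ← sum_trajProb s₁ M π c]
  refine Finset.sum_le_sum fun x _ => ?_
  by_cases hx : trajProb s₁ M π c x = 0
  · simp [hx]
  · exact mul_le_of_le_one_right (trajProb_nonneg _ _ _ _ _) (h.meanReturn_le_one π x hx)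

end Value

/-! ### Inequalities for the squared Hellinger distance -/

section Hellinger

variable {S : Type*} [Fintype S] {p q : S → ℝ}

lemma one_sub_sum_sqrt_mul (hp : ∀ s, 0 ≤ p s) (hq : ∀ s, 0 ≤ q s) (hp1 : ∑ s, p s = 1)
    (hq1 : ∑ s, q s = 1) : 1 - ∑ s, √(p s * q s) = (∑ s, (√(p s) - √(q s)) ^ 2) / 2 := by
  have h : ∀ s, (√(p s) - √(q s)) ^ 2 = p s + q s - 2 * √(p s * q s) := fun s => by
    rw [sub_sq, Real.sq_sqrt (hp s), Real.sq_sqrt (hq s), Real.sqrt_mul (hp s)]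
    ring
  simp only [h, Finset.sum_sub_distrib, Finset.sum_add_distrib, hp1, hq1, ← Finset.mul_sum]
  ring

/-- The factorization |p - q| = |√p - √q|(√p + √q) and the weighted AM-GM inequality. The free
parameter t keeps the bound linear in the Hellinger distance, so it can later be integrated over
contexts. -/
lemma sum_abs_sub_le_hellinger (hp : ∀ s, 0 ≤ p s) (hq : ∀ s, 0 ≤ q s) (hp1 : ∑ s, p s = 1)
    (hq1 : ∑ s, q s = 1) {t : ℝ} (ht : 0 < t) :
    ∑ s, |p s - q s| ≤ t / 2 + 4 / t * (1 - ∑ s, √(p s * q s)) := by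
  rw [one_sub_sum_sqrt_mul hp hq hp1 hq1]
  have h : ∀ s, |p s - q s| ≤ t / 4 * (p s + q s) + 2 / t * (√(p s) - √(q s)) ^ 2 := fun s => by
    have hps := Real.sq_sqrt (hp s)
    have hqs := Real.sq_sqrt (hq s)
    have h0 := Real.sqrt_nonneg (p s)
    have h1 := Real.sqrt_nonneg (q s)
    set x := √(p s)
    set y := √(q s)
    rw [← hps, ← hqs]
    have hxy : x ^ 2 - y ^ 2 = (x - y) * (x + y) := by ring
    rw [hxy, abs_mul, abs_of_nonneg (add_nonneg h0 h1)]
    have h2 : |x - y| * (x + y) ≤ t / 8 * (x + y) ^ 2 + 2 / t * (x - y) ^ 2 := by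
      have h3 : 0 ≤ 2 / t * (|x - y| - t / 4 * (x + y)) ^ 2 := by positivity
      have h4 : 2 / t * (|x - y| - t / 4 * (x + y)) ^ 2 =
          t / 8 * (x + y) ^ 2 + 2 / t * |x - y| ^ 2 - |x - y| * (x + y) := by
        field_simp; ring
      rw [h4, sq_abs] at h3
      linarith
    nlinarith [mul_nonneg ht.le (sq_nonneg (x - y))]
  refine (Finset.sum_le_sum fun s _ => h s).trans (le_of_eq ?_)
  rw [Finset.sum_add_distrib, ← Finset.mul_sum, ← Finset.mul_sum, Finset.sum_add_distrib, hp1, hq1]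
  ring

/-- A single coordinate with relative gap 1/H already costs a 1/H² fraction of its own mass. -/
lemma div_le_hellinger (hp : ∀ s, 0 ≤ p s) (hq : ∀ s, 0 ≤ q s) (hp1 : ∑ s, p s = 1)
    (hq1 : ∑ s, q s = 1) {H : ℝ} (hH : 1 ≤ H) (s : S) (hs : (1 + 1 / H) * p s < q s) :
    q s / (32 * H ^ 2) ≤ 1 - ∑ s, √(p s * q s) := by
  rw [one_sub_sum_sqrt_mul hp hq hp1 hq1]
  have h1 : (√(p s) - √(q s)) ^ 2 ≤ ∑ s, (√(p s) - √(q s)) ^ 2 :=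
    Finset.single_le_sum (f := fun s => (√(p s) - √(q s)) ^ 2) (fun _ _ => sq_nonneg _)
      (Finset.mem_univ s)
  have hH0 : 0 < H := by linarith
  have hb : 0 ≤ 1 - 1 / (4 * H) := by
    rw [sub_nonneg, div_le_one (by positivity)]; linarith
  have h2 : √(p s) ≤ (1 - 1 / (4 * H)) * √(q s) := by
    rw [← Real.sqrt_sq hb, ← Real.sqrt_mul (sq_nonneg _)]
    refine Real.sqrt_le_sqrt ?_
    have h3 : p s * (H + 1) ≤ H * q s := by
      have : (1 + 1 / H) * p s * H = p s * (H + 1) := by field_simp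
      nlinarith
    -- The choice of 1/(4H): its square satisfies (1 - 1/(4H))² ≥ 1 - 1/(2H), and 1/(2H) ≤ 1/(H + 1)
    -- because H ≥ 1.
    have h4 : H / (H + 1) ≤ (1 - 1 / (4 * H)) ^ 2 := by
      have h5 : (1 - 1 / (4 * H)) ^ 2 - H / (H + 1) =
          ((8 * H + 1) * (H - 1) + 2) / (16 * H ^ 2 * (H + 1)) := by
        field_simp; ring
      have : 0 ≤ ((8 * H + 1) * (H - 1) + 2) / (16 * H ^ 2 * (H + 1)) := by
        apply div_nonneg _ (by positivity)
        nlinarith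
      linarith
    calc p s ≤ H / (H + 1) * q s := by
          rw [div_mul_eq_mul_div, le_div_iff₀ (by positivity)]; exact h3
      _ ≤ _ := mul_le_mul_of_nonneg_right h4 (hq s)
  have h6 : q s / (16 * H ^ 2) ≤ (√(p s) - √(q s)) ^ 2 := by
    have h7 : 1 / (4 * H) * √(q s) ≤ √(q s) - √(p s) := by linarith
    have h8 := pow_le_pow_left₀ (by positivity) h7 2
    rw [mul_pow, Real.sq_sqrt (hq s)] at h8
    calc q s / (16 * H ^ 2) = (1 / (4 * H)) ^ 2 * q s := by field_simp; norm_num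
      _ ≤ _ := by rw [sub_sq_comm]; exact h8
  have : q s / (32 * H ^ 2) = q s / (16 * H ^ 2) / 2 := by field_simp; ring
  rw [this]
  linarith

end Hellinger

/-! ### Trusted chain, layer losses, and the value gap in a fixed context -/

section Trusted

variable {C S A : Type*} [MeasurableSpace C] [Fintype S] [Fintype A] [DecidableEq S]
  [MeasurableSpace S] [MeasurableSpace A] {n : ℕ}

/-- All policies have value 0 under the zero reward; this removes the exploitation side of the
algorithm, whatever the previous model is. -/
lemma Params.regHat_eq_zero {H : ℕ} (p : Params C S A H) (M : CMDP C S A H) (π : Policy S A H)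
    (c : C) : p.regHat M π c = 0 := by
  simp [Params.regHat, value_zeroReward]

lemma Params.gap_eq {H : ℕ} (p : Params C S A H) (m : ℕ) (prev : CMDP C S A H) (π : Policy S A H)
    (c : C) : p.gap m prev π c = (Fintype.card S : ℝ) * Fintype.card A := by
  simp [Params.gap, Params.regHat_eq_zero]

open Classical in
/-- The estimated transitions, with untrusted transitions removed. -/
noncomputable def Params.trustedKer (p : Params C S A (n + 1)) (m : ℕ) (prev cur : CMDP C S A (n + 1))
    (c : C) : ℕ → S → A → S → ℝ :=
  fun k s a s' =>
    if ∃ hk : k < n + 1, p.Trusted m prev cur c ⟨k, hk⟩ (p.trustedOcc m prev cur c k hk) s a s'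
    then modelKer cur c k s a s' else 0

variable (p : Params C S A (n + 1)) (m : ℕ) (prev cur M : CMDP C S A (n + 1)) (c : C)

lemma trustedKer_nonneg (k : ℕ) (s : S) (a : A) (s' : S) :
    0 ≤ p.trustedKer m prev cur c k s a s' := by
  rw [Params.trustedKer]
  split_ifs
  · exact modelKer_nonneg _ _ _ _ _ _
  · exact le_rfl

lemma trustedKer_le (k : ℕ) (s : S) (a : A) (s' : S) :
    p.trustedKer m prev cur c k s a s' ≤ modelKer cur c k s a s' := by
  rw [Params.trustedKer]
  split_ifs
  · exact le_rfl
  · exact modelKer_nonneg _ _ _ _ _ _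

lemma sum_trustedKer_le_one (k : ℕ) (s : S) (a : A) :
    ∑ s', p.trustedKer m prev cur c k s a s' ≤ 1 :=
  (Finset.sum_le_sum fun s' _ => trustedKer_le p m prev cur c k s a s').trans
    (sum_modelKer cur c k s a).le

/-- Deleting untrusted transitions from the recursion is the same as running a substochastic chain,
to which the chain estimates apply. -/
lemma trustedOcc_eq_occ (k : ℕ) (hk : k < n + 1) (π : Policy S A (n + 1)) (s : S) :
    p.trustedOcc m prev cur c k hk π s =
      occ p.s₁ (p.trustedKer m prev cur c) (polKer π) k s := by
  induction k generalizing s with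
  | zero => rfl
  | succ k ih =>
    have hk' : k < n + 1 := by omega
    simp only [Params.trustedOcc, occ]
    refine Finset.sum_congr rfl fun s' _ => Finset.sum_congr rfl fun a' _ => ?_
    rw [← ih hk', Params.trustedKer]
    simp only [polKer, modelKer, Fin.ofNat_eq_mk hk']
    by_cases hT : p.Trusted m prev cur c ⟨k, hk'⟩ (p.trustedOcc m prev cur c k hk') s' a' s
    · rw [if_pos hT, if_pos ⟨hk', hT⟩]
    · rw [if_neg hT, if_neg fun h => hT h.2, mul_zero]

/-- The trusted occupancy of state-action pairs. -/
noncomputable def Params.trustedPairOcc (k : ℕ) (π : Policy S A (n + 1)) (s : S) (a : A) : ℝ :=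
  occ p.s₁ (p.trustedKer m prev cur c) (polKer π) k s * polKer π k s a

lemma trustedOccSA_eq (k : ℕ) (hk : k < n + 1) (π : Policy S A (n + 1)) (s : S) (a : A) :
    p.trustedOccSA m prev cur c ⟨k, hk⟩ π s a = p.trustedPairOcc m prev cur c k π s a := by
  rw [Params.trustedOccSA, trustedOcc_eq_occ, Params.trustedPairOcc, polKer, Fin.ofNat_eq_mk hk]

lemma trustedPairOcc_nonneg (k : ℕ) (π : Policy S A (n + 1)) (s : S) (a : A) :
    0 ≤ p.trustedPairOcc m prev cur c k π s a :=
  mul_nonneg (occ_nonneg (trustedKer_nonneg p m prev cur c) (polKer_nonneg π) _ _)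
    (polKer_nonneg π _ _ _)

lemma sum_trustedPairOcc_le_one (k : ℕ) (π : Policy S A (n + 1)) :
    ∑ s, ∑ a, p.trustedPairOcc m prev cur c k π s a ≤ 1 := by
  simp only [Params.trustedPairOcc]
  rw [sum_occ_mul_policy (sum_polKer π)]
  exact sum_occ_le_one (trustedKer_nonneg p m prev cur c) (sum_trustedKer_le_one p m prev cur c)
    (polKer_nonneg π) (sum_polKer π) k

lemma trustedPairOcc_le_one (k : ℕ) (π : Policy S A (n + 1)) (s : S) (a : A) :
    p.trustedPairOcc m prev cur c k π s a ≤ 1 := by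
  have h := trustedPairOcc_nonneg p m prev cur c k π
  calc _ ≤ ∑ a, p.trustedPairOcc m prev cur c k π s a :=
        Finset.single_le_sum (f := fun a => p.trustedPairOcc m prev cur c k π s a)
          (fun a _ => h s a) (Finset.mem_univ a)
    _ ≤ ∑ s, ∑ a, p.trustedPairOcc m prev cur c k π s a :=
        Finset.single_le_sum (f := fun s => ∑ a, p.trustedPairOcc m prev cur c k π s a)
          (fun s _ => Finset.sum_nonneg fun a _ => h s a) (Finset.mem_univ s)
    _ ≤ 1 := sum_trustedPairOcc_le_one p m prev cur c k π

/-- The largest trusted occupancy of a state-action pair. -/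
noncomputable def Params.maxOcc (k : ℕ) (s : S) (a : A) : ℝ :=
  ⨆ π : Policy S A (n + 1), p.trustedPairOcc m prev cur c k π s a

lemma trustedPairOcc_le_maxOcc (k : ℕ) (π : Policy S A (n + 1)) (s : S) (a : A) :
    p.trustedPairOcc m prev cur c k π s a ≤ p.maxOcc m prev cur c k s a :=
  le_ciSup (f := fun π => p.trustedPairOcc m prev cur c k π s a)
    ⟨1, by rintro _ ⟨π, rfl⟩; exact trustedPairOcc_le_one p m prev cur c k π s a⟩ π

lemma maxOcc_nonneg (k : ℕ) (s : S) (a : A) : 0 ≤ p.maxOcc m prev cur c k s a :=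
  Real.iSup_nonneg fun π => trustedPairOcc_nonneg p m prev cur c k π s a

/-- The squared Hellinger distance of the transitions at layer `k`. -/
noncomputable def layerHellinger (M M' : CMDP C S A (n + 1)) (c : C) (k : ℕ) (s : S) (a : A) : ℝ :=
  1 - ∑ s', affKer (modelKer M c) (modelKer M' c) k s a s'

lemma layerHellinger_nonneg (k : ℕ) (s : S) (a : A) : 0 ≤ layerHellinger M cur c k s a :=
  sub_nonneg.2 (sum_affKer_le_one (modelKer_nonneg M c) (modelKer_nonneg cur c) (sum_modelKer M c)
    (sum_modelKer cur c) k s a)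

/-- Up to layer `k`, trusted transition probabilities hardly exceed those of `M`. -/
def Params.Dominated (k : ℕ) : Prop :=
  ∀ j < k, ∀ s a s', p.trustedKer m prev cur c j s a s' ≤
    (1 + 1 / ((n : ℝ) + 1)) * modelKer M c j s a s'

open Classical in
/-- The estimation error at layer `k`, weighted by the largest trusted occupancies, on contexts
where the earlier layers are under control. -/
noncomputable def Params.loss (k : ℕ) : ℝ :=
  if p.Dominated m prev cur M c k then
    ∑ s, ∑ a, p.maxOcc m prev cur c k s a * layerHellinger M cur c k s a else 0

lemma loss_nonneg (k : ℕ) : 0 ≤ p.loss m prev cur M c k := by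
  rw [Params.loss]
  split_ifs
  · exact Finset.sum_nonneg fun s _ => Finset.sum_nonneg fun a _ =>
      mul_nonneg (maxOcc_nonneg p m prev cur c k s a) (layerHellinger_nonneg cur M c k s a)
  · exact le_rfl

/-- A deleted transition misses the threshold 1/ζ for every policy, and the denominator in that test
is SA. -/
lemma trustedPairOcc_mul_untrusted_le (hζ : 0 < p.ζ m) {k : ℕ} (hk : k < n + 1)
    (π : Policy S A (n + 1)) (s : S) (a : A) (s' : S) :
    p.trustedPairOcc m prev cur c k π s a *
      (modelKer cur c k s a s' - p.trustedKer m prev cur c k s a s') ≤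
      (Fintype.card S : ℝ) * Fintype.card A / p.ζ m := by
  have hSA : 0 ≤ (Fintype.card S : ℝ) * Fintype.card A := by positivity
  rw [Params.trustedKer]
  split_ifs with h
  · rw [sub_self, mul_zero]
    exact div_nonneg hSA hζ.le
  · rw [sub_zero]
    simp only [hk, exists_true_left, Params.Trusted, not_exists, not_le, Params.gap_eq] at h
    have h1 := h π
    rw [trustedOcc_eq_occ] at h1
    have hS : 0 < (Fintype.card S : ℝ) := by exact_mod_cast Fintype.card_pos_iff.2 ⟨s⟩
    have hA : 0 < (Fintype.card A : ℝ) := by exact_mod_cast Fintype.card_pos_iff.2 ⟨a⟩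
    rw [div_mul_eq_mul_div, div_lt_iff₀ (by positivity), one_div_mul_eq_div] at h1
    refine le_trans (le_of_eq ?_) h1.le
    simp only [Params.trustedPairOcc, polKer, modelKer, Fin.ofNat_eq_mk hk]

/-- The converse side of the threshold: a transition that is kept has a policy witnessing it. -/
lemma le_maxOcc_mul_of_trustedKer_ne_zero {k : ℕ} {s : S} {a : A} {s' : S}
    (h : p.trustedKer m prev cur c k s a s' ≠ 0) :
    (Fintype.card S : ℝ) * Fintype.card A / p.ζ m ≤
      p.maxOcc m prev cur c k s a * modelKer cur c k s a s' := by
  rw [Params.trustedKer] at h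
  split_ifs at h with h0
  swap
  · exact absurd rfl h
  obtain ⟨hk, π, h1⟩ := h0
  rw [Params.gap_eq, trustedOcc_eq_occ] at h1
  have hS : 0 < (Fintype.card S : ℝ) := by exact_mod_cast Fintype.card_pos_iff.2 ⟨s⟩
  have hA : 0 < (Fintype.card A : ℝ) := by exact_mod_cast Fintype.card_pos_iff.2 ⟨a⟩
  rw [div_mul_eq_mul_div, le_div_iff₀ (by positivity), one_div_mul_eq_div] at h1
  refine h1.trans (le_trans (le_of_eq ?_) (mul_le_mul_of_nonneg_right
    (trustedPairOcc_le_maxOcc p m prev cur c k π s a) (modelKer_nonneg cur c k s a s')))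
  simp only [Params.trustedPairOcc, polKer, modelKer, Fin.ofNat_eq_mk hk]

variable {p m prev cur M c}

/-- On contexts where the trusted transitions are dominated, the values are close. -/
lemma abs_value_sub_le_of_dominated (hζ : 0 < p.ζ m) {t : ℝ} (ht : 0 < t)
    {R : Reward C S A (n + 1)} (hR : BoundedReturn p.s₁ M R c) (hR' : BoundedReturn p.s₁ cur R c)
    (π : Policy S A (n + 1)) (hdom : p.Dominated m prev cur M c n) :
    |value p.s₁ M R π c - value p.s₁ cur R π c| ≤ t * (n + 1) +
      2 * (n + 1) * ((Fintype.card S : ℝ) ^ 3 * (Fintype.card A : ℝ) ^ 2 / p.ζ m) +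
      8 / t * ∑ k ∈ Finset.range n, p.loss m prev cur M c k := by
  have hker := trustedKer_nonneg p m prev cur c
  have h1 := abs_sum_chainWeight_mul_sub_le (s₁ := p.s₁) hker
    (modelKer_nonneg M c) (modelKer_nonneg cur c) (sum_modelKer M c) (sum_modelKer cur c)
    (polKer_nonneg π) (sum_polKer π) n (fun j _ => trustedKer_le p m prev cur c j)
    -- Domination forces a trusted transition to be possible under the true model.
    (fun j hj s a s' h0 h => h0 (le_antisymm (by simpa [h] using hdom j hj s a s')
      (hker j s a s')))
    (meanReturn R c) (meanReturn_nonneg R c)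
    (fun x hx => hR.meanReturn_le_one π x (by rwa [trajProb_eq_chainWeight]))
    (fun x hx => hR'.meanReturn_le_one π x (by rwa [trajProb_eq_chainWeight]))
  simp only [value_eq_sum, trajProb_eq_chainWeight]
  refine h1.trans ?_
  have hlayer : ∀ k ∈ Finset.range n, ∑ s, ∑ a, occ p.s₁ (p.trustedKer m prev cur c) (polKer π) k s *
      polKer π k s a * ∑ s', |modelKer M c k s a s' - p.trustedKer m prev cur c k s a s'| ≤
      t / 2 + (Fintype.card S : ℝ) ^ 3 * (Fintype.card A : ℝ) ^ 2 / p.ζ m +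
        4 / t * p.loss m prev cur M c k := by
    intro k hk
    rw [Finset.mem_range] at hk
    have hpair : ∀ s a, occ p.s₁ (p.trustedKer m prev cur c) (polKer π) k s * polKer π k s a *
        ∑ s', |modelKer M c k s a s' - p.trustedKer m prev cur c k s a s'| ≤
        p.trustedPairOcc m prev cur c k π s a * (t / 2) +
        (Fintype.card S : ℝ) * ((Fintype.card S : ℝ) * Fintype.card A / p.ζ m) +
        4 / t * (p.maxOcc m prev cur c k s a * layerHellinger M cur c k s a) := by
      intro s a
      change p.trustedPairOcc m prev cur c k π s a * _ ≤ _
      have h0 := trustedPairOcc_nonneg p m prev cur c k π s a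
      have h2 := sum_abs_sub_le_hellinger (modelKer_nonneg M c k s a)
        (modelKer_nonneg cur c k s a) (sum_modelKer M c k s a) (sum_modelKer cur c k s a) ht
      -- The full estimate is inserted between the truth and the trusted kernel: first the
      -- estimation error, then the deleted mass, which has a sign.
      have h3 : ∑ s', |modelKer M c k s a s' - p.trustedKer m prev cur c k s a s'| ≤
          t / 2 + 4 / t * layerHellinger M cur c k s a +
          ∑ s', (modelKer cur c k s a s' - p.trustedKer m prev cur c k s a s') := by
        refine le_trans ?_ (add_le_add_left h2 _)
        rw [← Finset.sum_add_distrib]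
        refine Finset.sum_le_sum fun s' _ => ?_
        have := abs_sub_le (modelKer M c k s a s') (modelKer cur c k s a s')
          (p.trustedKer m prev cur c k s a s')
        rwa [abs_of_nonneg (sub_nonneg.2 (trustedKer_le p m prev cur c k s a s'))] at this
      have h4 : p.trustedPairOcc m prev cur c k π s a *
          ∑ s', (modelKer cur c k s a s' - p.trustedKer m prev cur c k s a s') ≤
          (Fintype.card S : ℝ) * ((Fintype.card S : ℝ) * Fintype.card A / p.ζ m) := by
        rw [Finset.mul_sum]
        refine (Finset.sum_le_card_nsmul _ _ _ fun s' _ =>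
          trustedPairOcc_mul_untrusted_le p m prev cur c hζ (by omega) π s a s').trans ?_
        simp
      have h5 : p.trustedPairOcc m prev cur c k π s a * layerHellinger M cur c k s a ≤
          p.maxOcc m prev cur c k s a * layerHellinger M cur c k s a :=
        mul_le_mul_of_nonneg_right (trustedPairOcc_le_maxOcc p m prev cur c k π s a)
          (layerHellinger_nonneg _ _ _ _ _ _)
      have h6 : 0 ≤ 4 / t := by positivity
      nlinarith [mul_le_mul_of_nonneg_left h3 h0, mul_le_mul_of_nonneg_left h5 h6]
    refine (Finset.sum_le_sum fun s _ => Finset.sum_le_sum fun a _ => hpair s a).trans ?_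
    have hloss : p.loss m prev cur M c k =
        ∑ s, ∑ a, p.maxOcc m prev cur c k s a * layerHellinger M cur c k s a :=
      if_pos fun j hj => hdom j (by omega)
    have := mul_le_mul_of_nonneg_right (sum_trustedPairOcc_le_one p m prev cur c k π)
      (by positivity : 0 ≤ t / 2)
    -- There are SA pairs with at most S deleted successors each, and each of these contributes at
    -- most SA/ζ.
    have h7 : ∑ _s : S, ∑ _a : A,
        (Fintype.card S : ℝ) * ((Fintype.card S : ℝ) * Fintype.card A / p.ζ m) =
        (Fintype.card S : ℝ) ^ 3 * (Fintype.card A : ℝ) ^ 2 / p.ζ m := by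
      simp only [Finset.sum_const, Finset.card_univ, nsmul_eq_mul]; ring
    simp only [Finset.sum_add_distrib]
    rw [h7]
    simp only [← Finset.mul_sum, ← Finset.sum_mul, hloss]
    linarith
  have h8 := Finset.sum_le_sum hlayer
  rw [Finset.sum_add_distrib, ← Finset.mul_sum, Finset.sum_const, Finset.card_range,
    nsmul_eq_mul] at h8
  set L := ∑ k ∈ Finset.range n, p.loss m prev cur M c k
  have h9 : 0 ≤ (Fintype.card S : ℝ) ^ 3 * (Fintype.card A : ℝ) ^ 2 / p.ζ m := by positivity
  have h10 : 8 / t * L = 2 * (4 / t * L) := by ring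
  rw [h10]
  nlinarith

/-- If the trusted transitions are not dominated, then some layer has a large loss. -/
lemma one_le_loss_of_not_dominated (hζ : 0 < p.ζ m) (hdom : ¬ p.Dominated m prev cur M c n) :
    1 ≤ 32 * ((n : ℝ) + 1) ^ 2 * p.ζ m / ((Fintype.card S : ℝ) * Fintype.card A) *
      ∑ k ∈ Finset.range n, p.loss m prev cur M c k := by
  classical
  -- Taking the first layer at which domination fails ensures that the loss of this layer is not
  -- switched off by its definition.
  obtain ⟨k, hk, hk1, hk2⟩ : ∃ k < n, p.Dominated m prev cur M c k ∧
      ¬ p.Dominated m prev cur M c (k + 1) := by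
    have hex : ∃ k, ¬ p.Dominated m prev cur M c k := ⟨n, hdom⟩
    have hpos : Nat.find hex ≠ 0 := fun h0 => by
      have := Nat.find_spec hex
      rw [h0] at this
      exact this fun j hj => absurd hj (by omega)
    have hle : Nat.find hex ≤ n := Nat.find_min' hex hdom
    refine ⟨Nat.find hex - 1, by omega, not_not.1 (Nat.find_min hex (by omega)), ?_⟩
    rw [Nat.sub_add_cancel (by omega)]
    exact Nat.find_spec hex
  obtain ⟨s, a, s', hs⟩ : ∃ s a s', (1 + 1 / ((n : ℝ) + 1)) * modelKer M c k s a s' <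
      p.trustedKer m prev cur c k s a s' := by
    by_contra! hcon
    refine hk2 fun j hj => ?_
    rcases Nat.lt_succ_iff_lt_or_eq.1 hj with h | rfl
    · exact hk1 j h
    · exact hcon
  have hM := modelKer_nonneg M c k s a s'
  have hne : p.trustedKer m prev cur c k s a s' ≠ 0 := by
    have : 0 ≤ (1 + 1 / ((n : ℝ) + 1)) * modelKer M c k s a s' := by positivity
    linarith
  have h1 := le_maxOcc_mul_of_trustedKer_ne_zero p m prev cur c hne
  have h2 : modelKer cur c k s a s' / (32 * ((n : ℝ) + 1) ^ 2) ≤ layerHellinger M cur c k s a :=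
    div_le_hellinger (modelKer_nonneg M c k s a) (modelKer_nonneg cur c k s a)
      (sum_modelKer M c k s a) (sum_modelKer cur c k s a) (by simp) s'
      (hs.trans_le (trustedKer_le p m prev cur c k s a s'))
  have hmax := maxOcc_nonneg p m prev cur c k
  have h3 : p.maxOcc m prev cur c k s a * layerHellinger M cur c k s a ≤
      p.loss m prev cur M c k := by
    rw [Params.loss, if_pos hk1]
    have h0 : ∀ s a, 0 ≤ p.maxOcc m prev cur c k s a * layerHellinger M cur c k s a :=
      fun s a => mul_nonneg (hmax s a) (layerHellinger_nonneg _ _ _ _ _ _)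
    exact (Finset.single_le_sum (f := fun a => p.maxOcc m prev cur c k s a *
        layerHellinger M cur c k s a) (fun a _ => h0 s a) (Finset.mem_univ a)).trans
      (Finset.single_le_sum (f := fun s => ∑ a, p.maxOcc m prev cur c k s a *
        layerHellinger M cur c k s a) (fun s _ => Finset.sum_nonneg fun a _ => h0 s a)
        (Finset.mem_univ s))
  have h4 : p.loss m prev cur M c k ≤ ∑ k ∈ Finset.range n, p.loss m prev cur M c k :=
    Finset.single_le_sum (fun j _ => loss_nonneg p m prev cur M c j) (Finset.mem_range.2 hk)
  have hS : 0 < (Fintype.card S : ℝ) := by exact_mod_cast Fintype.card_pos_iff.2 ⟨s⟩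
  have hA : 0 < (Fintype.card A : ℝ) := by exact_mod_cast Fintype.card_pos_iff.2 ⟨a⟩
  have h5 : (Fintype.card S : ℝ) * Fintype.card A / p.ζ m / (32 * ((n : ℝ) + 1) ^ 2) ≤
      ∑ k ∈ Finset.range n, p.loss m prev cur M c k := by
    refine le_trans ?_ (h3.trans h4)
    refine le_trans ?_ (mul_le_mul_of_nonneg_left h2 (hmax s a))
    rw [← mul_div_assoc]
    gcongr
  calc (1 : ℝ) = 32 * ((n : ℝ) + 1) ^ 2 * p.ζ m / ((Fintype.card S : ℝ) * Fintype.card A) *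
      ((Fintype.card S : ℝ) * Fintype.card A / p.ζ m / (32 * ((n : ℝ) + 1) ^ 2)) := by
        field_simp
    _ ≤ _ := by gcongr

/-- On contexts without domination the gap is still at most 1, because both values lie in [0, 1],
and the loss is then large enough to pay for it. The resulting bound no longer distinguishes good
and bad contexts. -/
lemma abs_value_sub_le (hζ : 0 < p.ζ m) {t : ℝ} (ht : 0 < t)
    {R : Reward C S A (n + 1)} (hR : BoundedReturn p.s₁ M R c) (hR' : BoundedReturn p.s₁ cur R c)
    (π : Policy S A (n + 1)) :
    |value p.s₁ M R π c - value p.s₁ cur R π c| ≤ t * (n + 1) +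
      2 * (n + 1) * ((Fintype.card S : ℝ) ^ 3 * (Fintype.card A : ℝ) ^ 2 / p.ζ m) +
      (8 / t + 32 * ((n : ℝ) + 1) ^ 2 * p.ζ m / ((Fintype.card S : ℝ) * Fintype.card A)) *
        ∑ k ∈ Finset.range n, p.loss m prev cur M c k := by
  have hL : 0 ≤ ∑ k ∈ Finset.range n, p.loss m prev cur M c k :=
    Finset.sum_nonneg fun j _ => loss_nonneg p m prev cur M c j
  rw [add_mul]
  by_cases hdom : p.Dominated m prev cur M c n
  · refine (abs_value_sub_le_of_dominated hζ ht hR hR' π hdom).trans ?_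
    have : 0 ≤ 32 * ((n : ℝ) + 1) ^ 2 * p.ζ m / ((Fintype.card S : ℝ) * Fintype.card A) *
      ∑ k ∈ Finset.range n, p.loss m prev cur M c k := by positivity
    linarith
  · have h1 := one_le_loss_of_not_dominated hζ hdom
    have h2 : |value p.s₁ M R π c - value p.s₁ cur R π c| ≤ 1 := by
      rw [abs_le]
      have := value_nonneg p.s₁ M R π c
      have := value_nonneg p.s₁ cur R π c
      have := hR.value_le_one π
      have := hR'.value_le_one π
      constructor <;> linarith
    have h3 : 0 ≤ t * ((n : ℝ) + 1) + 2 * (n + 1) *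
      ((Fintype.card S : ℝ) ^ 3 * (Fintype.card A : ℝ) ^ 2 / p.ζ m) := by positivity
    have h4 : 0 ≤ 8 / t * ∑ k ∈ Finset.range n, p.loss m prev cur M c k := by positivity
    linarith

end Trusted

/-! ### The policy cover and its uniform law -/

section Cover

variable {C S A : Type*} [MeasurableSpace C] [Fintype S] [Fintype A] [DecidableEq S]
  [MeasurableSpace S] [MeasurableSpace A] {n : ℕ}
  {p : Params C S A (n + 1)} {m : ℕ} {prev cur cur' M M' : CMDP C S A (n + 1)} {c : C}

/-- Whether a transition is trusted is decided by the estimates of its own and earlier layers. -/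
lemma trustedKer_congr {k : ℕ} (h : ∀ i : Fin (n + 1), i.val < k → cur.P i = cur'.P i) (j : ℕ)
    (hj : j < k) : p.trustedKer m prev cur c j = p.trustedKer m prev cur' c j := by
  induction j using Nat.strong_induction_on with
  | _ j ih =>
    have hd : ∀ hk, p.trustedOcc m prev cur c j hk = p.trustedOcc m prev cur' c j hk := by
      intro hk
      funext π s
      rw [trustedOcc_eq_occ, trustedOcc_eq_occ,
        occ_congr j (fun i hi => ih i hi (hi.trans hj)) fun i _ => rfl]
    funext s a s'
    have hmod : ∀ hk : j < n + 1, cur.P ⟨j, hk⟩ = cur'.P ⟨j, hk⟩ := fun hk => h _ hj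
    rw [Params.trustedKer, Params.trustedKer]
    by_cases hk : j < n + 1
    · refine @if_congr _ _ _ (_) (_) _ _ _ _ ?_ ?_ rfl
      · simp only [Params.Trusted, hd, hmod hk]
      · simp only [modelKer, Fin.ofNat_eq_mk hk, hmod hk]
    · simp [hk]

lemma trustedPairOcc_congr {k : ℕ} (h : ∀ i : Fin (n + 1), i.val < k → cur.P i = cur'.P i) :
    p.trustedPairOcc m prev cur c k = p.trustedPairOcc m prev cur' c k := by
  funext π s a
  rw [Params.trustedPairOcc, Params.trustedPairOcc,
    occ_congr k (fun j hj => trustedKer_congr h j hj) fun _ _ => rfl]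

lemma maxOcc_congr {k : ℕ} (h : ∀ i : Fin (n + 1), i.val < k → cur.P i = cur'.P i) :
    p.maxOcc m prev cur c k = p.maxOcc m prev cur' c k := by
  funext s a
  simp only [Params.maxOcc, trustedPairOcc_congr h]

lemma layerHellinger_congr {k : ℕ} (hk : k < n + 1) (h : cur.P ⟨k, hk⟩ = cur'.P ⟨k, hk⟩) :
    layerHellinger M cur c k = layerHellinger M cur' c k := by
  funext s a
  simp only [layerHellinger, affKer, modelKer, Fin.ofNat_eq_mk hk, h]

lemma dominated_congr {k : ℕ} (h : ∀ i : Fin (n + 1), i.val < k → cur.P i = cur'.P i) :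
    p.Dominated m prev cur M c k ↔ p.Dominated m prev cur' M c k := by
  refine forall_congr' fun j => forall_congr' fun hj => ?_
  rw [trustedKer_congr h j hj]

/-- The loss of a layer is fixed once this layer is estimated; later segments cannot alter it. -/
lemma loss_congr {k : ℕ} (hk : k < n + 1)
    (h : ∀ i : Fin (n + 1), i.val ≤ k → cur.P i = cur'.P i) :
    p.loss m prev cur M c k = p.loss m prev cur' M c k := by
  have h' : ∀ i : Fin (n + 1), i.val < k → cur.P i = cur'.P i := fun i hi => h i hi.le
  refine @if_congr _ _ _ (_) (_) _ _ _ _ (dominated_congr h') ?_ rfl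
  simp only [maxOcc_congr h', layerHellinger_congr hk (h ⟨k, hk⟩ le_rfl)]

instance [Nonempty A] : Nonempty (stdSimplex ℝ A) := by
  classical
  exact ⟨⟨Pi.single (Classical.arbitrary A) 1, single_mem_stdSimplex ℝ _⟩⟩

/-- The denominator in the exploration objective is constant, so its maximizer attains the supremum.
This also replaces an uncountable supremum by a measurable selection. -/
lemma maxOcc_eq_explore (ch : Choices p) {k : ℕ} (hk : k < n + 1) (s : S) (a : A) :
    p.maxOcc m prev cur c k s a =
      p.trustedPairOcc m prev cur c k (ch.explore m ⟨k, hk⟩ prev cur s a c) s a := by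
  have : Nonempty A := ⟨a⟩
  refine le_antisymm (ciSup_le fun π => ?_) (trustedPairOcc_le_maxOcc _ _ _ _ _ _ _ _ _)
  have h := ch.explore_max m ⟨k, hk⟩ prev cur s a c π
  simp only [Params.gap_eq, trustedOccSA_eq] at h
  have hS : 0 < (Fintype.card S : ℝ) := by exact_mod_cast Fintype.card_pos_iff.2 ⟨s⟩
  have hA : 0 < (Fintype.card A : ℝ) := by exact_mod_cast Fintype.card_pos_iff.2 ⟨a⟩
  exact (div_le_div_iff_of_pos_right (by positivity)).1 h

/-- Domination costs a factor 1 + 1/H per step, and over at most H steps the product stays below e.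
-/
lemma trustedPairOcc_le_of_dominated {k : ℕ} (hk : k < n + 1) (hdom : p.Dominated m prev cur M c k)
    (π : Policy S A (n + 1)) (s : S) (a : A) :
    p.trustedPairOcc m prev cur c k π s a ≤
      Real.exp 1 * (occ p.s₁ (modelKer M c) (polKer π) k s * polKer π k s a) := by
  have h1 := occ_le_pow_mul (s₁ := p.s₁) (trustedKer_nonneg p m prev cur c) (modelKer_nonneg M c)
    (polKer_nonneg π) (by positivity : 0 ≤ 1 + 1 / ((n : ℝ) + 1)) k hdom s
  have h2 : (1 + 1 / ((n : ℝ) + 1)) ^ k ≤ Real.exp 1 := by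
    have h3 : 1 + 1 / ((n : ℝ) + 1) ≤ Real.exp (1 / ((n : ℝ) + 1)) := by
      have := Real.add_one_le_exp (1 / ((n : ℝ) + 1))
      linarith
    refine (pow_le_pow_left₀ (by positivity) h3 k).trans ?_
    rw [← Real.exp_nat_mul, Real.exp_le_exp, mul_one_div, div_le_one (by positivity)]
    exact_mod_cast hk.le
  have h3 := occ_nonneg (s₁ := p.s₁) (modelKer_nonneg M c) (polKer_nonneg π) k s
  rw [Params.trustedPairOcc, ← mul_assoc]
  exact mul_le_mul_of_nonneg_right (h1.trans (mul_le_mul_of_nonneg_right h2 h3))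
    (polKer_nonneg π _ _ _)

/-- The Hellinger affinity of the trajectory laws of two models. -/
noncomputable def affinity {H : ℕ} (s₁ : S) (M M' : CMDP C S A H) (π : Policy S A H) (c : C) : ℝ :=
  ∑ x, √(trajProb s₁ M π c x * trajProb s₁ M' π c x)

lemma affinity_eq (s₁ : S) (π : Policy S A (n + 1)) :
    affinity s₁ M M' π c =
      ∑ s, occ s₁ (affKer (modelKer M c) (modelKer M' c)) (polKer π) n s := by
  rw [← sum_chainWeight (sum_polKer π), affinity]
  refine Finset.sum_congr rfl fun x _ => ?_
  rw [trajProb_eq_chainWeight, trajProb_eq_chainWeight, sqrt_chainWeight_mul (modelKer_nonneg M c)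
    (modelKer_nonneg M' c) (polKer_nonneg π)]

lemma affinity_nonneg {H : ℕ} (s₁ : S) (M M' : CMDP C S A H) (π : Policy S A H) (c : C) :
    0 ≤ affinity s₁ M M' π c :=
  Finset.sum_nonneg fun _ _ => Real.sqrt_nonneg _

lemma affinity_le_one (s₁ : S) (M M' : CMDP C S A (n + 1)) (π : Policy S A (n + 1)) (c : C) :
    affinity s₁ M M' π c ≤ 1 := by
  rw [affinity_eq]
  exact sum_occ_le_one affKer_nonneg (sum_affKer_le_one (modelKer_nonneg M c)
    (modelKer_nonneg M' c) (sum_modelKer M c) (sum_modelKer M' c)) (polKer_nonneg π)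
    (sum_polKer π) n

lemma maxOcc_le_sum_cover (ch : Choices p) {k : ℕ} (hk : k < n + 1)
    (hdom : p.Dominated m prev cur M c k) (s : S) (a : A) :
    p.maxOcc m prev cur c k s a ≤ Real.exp 1 * ∑ π ∈ ch.cover m ⟨k, hk⟩ prev cur c,
      occ p.s₁ (modelKer M c) (polKer π) k s * polKer π k s a := by
  classical
  rw [maxOcc_eq_explore ch hk]
  refine (trustedPairOcc_le_of_dominated hk hdom _ s a).trans ?_
  refine mul_le_mul_of_nonneg_left ?_ (Real.exp_pos 1).le
  refine Finset.single_le_sum (f := fun π => occ p.s₁ (modelKer M c) (polKer π) k s *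
    polKer π k s a) (fun π _ => mul_nonneg (occ_nonneg (modelKer_nonneg M c) (polKer_nonneg π) k s)
      (polKer_nonneg π k s a)) ?_
  rw [Choices.cover, Finset.mem_insert, Finset.mem_image]
  exact Or.inr ⟨(s, a), Finset.mem_univ _, rfl⟩

lemma replaceLayer_P_of_ne {H : ℕ} (M M' : CMDP C S A H) {i h : Fin H} (hi : i ≠ h) :
    (M.replaceLayer M' h).P i = M.P i :=
  if_neg hi

lemma replaceLayer_P_self {H : ℕ} (M M' : CMDP C S A H) (h : Fin H) :
    (M.replaceLayer M' h).P h = M'.P h :=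
  if_pos rfl

/-- The loss at a freshly estimated layer is bounded by the Hellinger distances of the trajectory
laws under the policies of the cover. -/
lemma loss_replaceLayer_le (ch : Choices p) {k : ℕ} (hk : k < n) (hk' : k < n + 1) :
    p.loss m prev (cur.replaceLayer M' ⟨k, hk'⟩) M c k ≤ 2 * Real.exp 1 *
      ∑ π ∈ ch.cover m ⟨k, hk'⟩ prev cur c, (1 - affinity p.s₁ M M' π c) := by
  -- The cover was computed before layer k was replaced, but trusted occupancies at layer k see only
  -- the earlier layers.
  have hcongr : ∀ i : Fin (n + 1), i.val < k → cur.P i = (cur.replaceLayer M' ⟨k, hk'⟩).P i :=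
    fun i hi => (replaceLayer_P_of_ne _ _ (by rintro rfl; exact lt_irrefl _ hi)).symm
  rw [Params.loss]
  split_ifs with hdom
  · rw [← dominated_congr hcongr] at hdom
    rw [← maxOcc_congr hcongr, layerHellinger_congr hk' (replaceLayer_P_self cur M' _)]
    calc _ ≤ ∑ s, ∑ a, (Real.exp 1 * ∑ π ∈ ch.cover m ⟨k, hk'⟩ prev cur c,
          occ p.s₁ (modelKer M c) (polKer π) k s * polKer π k s a) *
          layerHellinger M M' c k s a :=
          Finset.sum_le_sum fun s _ => Finset.sum_le_sum fun a _ => mul_le_mul_of_nonneg_right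
            (maxOcc_le_sum_cover ch hk' hdom s a) (layerHellinger_nonneg _ _ _ _ _ _)
      _ = Real.exp 1 * ∑ π ∈ ch.cover m ⟨k, hk'⟩ prev cur c, ∑ s, ∑ a,
          occ p.s₁ (modelKer M c) (polKer π) k s * polKer π k s a *
          layerHellinger M M' c k s a := by
          simp only [Finset.mul_sum, Finset.sum_mul, mul_assoc]
          rw [Finset.sum_comm (s := ch.cover m ⟨k, hk'⟩ prev cur c)]
          exact Finset.sum_congr rfl fun s _ => Finset.sum_comm
      _ ≤ Real.exp 1 * ∑ π ∈ ch.cover m ⟨k, hk'⟩ prev cur c,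
          2 * (1 - affinity p.s₁ M M' π c) := by
          refine mul_le_mul_of_nonneg_left (Finset.sum_le_sum fun π _ => ?_) (Real.exp_pos 1).le
          rw [affinity_eq]
          exact sum_occ_mul_hellinger_le (modelKer_nonneg M c) (modelKer_nonneg M' c)
            (sum_modelKer M c) (sum_modelKer M' c) (polKer_nonneg π) (sum_polKer π) hk
      _ = _ := by rw [← Finset.mul_sum]; ring
  · refine mul_nonneg (by positivity) (Finset.sum_nonneg fun π _ => ?_)
    exact sub_nonneg.2 (affinity_le_one _ _ _ _ _)

lemma cover_nonempty {H : ℕ} {p : Params C S A H} {prev cur : CMDP C S A H} (ch : Choices p)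
    (h : Fin H) : (ch.cover m h prev cur c).Nonempty :=
  Finset.insert_nonempty _ _

lemma card_cover_le {H : ℕ} {p : Params C S A H} {prev cur : CMDP C S A H} (ch : Choices p)
    (h : Fin H) :
    (ch.cover m h prev cur c).card ≤ Fintype.card S * Fintype.card A + 1 := by
  refine (Finset.card_insert_le _ _).trans (Nat.succ_le_succ (Finset.card_image_le.trans ?_))
  simp

/-- With zero gaps the normalizer is the size of the cover, so the law played is uniform. -/
lemma igwNorm_zero {X : Type*} {F : Finset X} (hF : F.Nonempty) :
    igwNorm F (fun _ => 0) = F.card := by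
  have hpos : 0 < (F.card : ℝ) := by exact_mod_cast hF.card_pos
  have h : 0 < igwNorm F (fun _ => 0) ∧ ∑ π ∈ F, 1 / (igwNorm F (fun _ => 0) + 0) = 1 :=
    Classical.epsilon_spec (p := fun l : ℝ => 0 < l ∧ ∑ π ∈ F, 1 / (l + 0) = 1)
      ⟨F.card, hpos, by simp [hpos.ne']⟩
  have h2 := h.2
  rw [Finset.sum_const, nsmul_eq_mul, add_zero, mul_one_div, div_eq_one_iff_eq h.1.ne'] at h2
  exact h2.symm

lemma policyLaw_eq {H : ℕ} {p : Params C S A H} {prev cur : CMDP C S A H} (ch : Choices p)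
    (h : Fin H) : ch.policyLaw m h prev cur c = ∑ π ∈ ch.cover m h prev cur c,
      (((ch.cover m h prev cur c).card : ENNReal)⁻¹) • Measure.dirac π := by
  have hpos : 0 < ((ch.cover m h prev cur c).card : ℝ) := by
    exact_mod_cast (cover_nonempty ch h).card_pos
  simp only [Choices.policyLaw, Params.regHat_eq_zero, mul_zero, add_zero,
    igwNorm_zero (cover_nonempty ch h)]
  rw [one_div, ENNReal.ofReal_inv_of_pos hpos, ENNReal.ofReal_natCast]

lemma lintegral_policyLaw {H : ℕ} {p : Params C S A H} {prev cur : CMDP C S A H} (ch : Choices p)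
    (h : Fin H) (f : Policy S A H → ENNReal) :
    ∫⁻ π, f π ∂(ch.policyLaw m h prev cur c) =
      ((ch.cover m h prev cur c).card : ENNReal)⁻¹ * ∑ π ∈ ch.cover m h prev cur c, f π := by
  rw [policyLaw_eq, lintegral_finsetSum_measure, Finset.mul_sum]
  refine Finset.sum_congr rfl fun π _ => ?_
  rw [lintegral_smul_measure, lintegral_dirac, smul_eq_mul]

instance {H : ℕ} {p : Params C S A H} {prev cur : CMDP C S A H} (ch : Choices p) (h : Fin H) :
    IsProbabilityMeasure (ch.policyLaw m h prev cur c) := by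
  constructor
  have h1 := lintegral_policyLaw (m := m) (c := c) (prev := prev) (cur := cur) ch h fun _ => 1
  rw [lintegral_one] at h1
  rw [h1, Finset.sum_const, nsmul_eq_mul, mul_one, ENNReal.inv_mul_cancel]
  · exact_mod_cast (cover_nonempty ch h).card_ne_zero
  · exact ENNReal.natCast_ne_top _

/-- A sum over the cover is its size times the mean under the uniform law, and the size is at most
SA + 1. -/
lemma ofReal_loss_replaceLayer_le (ch : Choices p) {k : ℕ} (hk : k < n) (hk' : k < n + 1) :
    ENNReal.ofReal (p.loss m prev (cur.replaceLayer M' ⟨k, hk'⟩) M c k) ≤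
      ENNReal.ofReal (2 * Real.exp 1 * ((Fintype.card S : ℝ) * Fintype.card A + 1)) *
        ∫⁻ π, ENNReal.ofReal (1 - affinity p.s₁ M M' π c)
          ∂(ch.policyLaw m ⟨k, hk'⟩ prev cur c) := by
  have h0 : ∀ π, 0 ≤ 1 - affinity p.s₁ M M' π c := fun π =>
    sub_nonneg.2 (affinity_le_one _ _ _ _ _)
  refine (ENNReal.ofReal_le_ofReal (loss_replaceLayer_le ch hk hk')).trans ?_
  have he : 0 ≤ 2 * Real.exp 1 := by positivity
  rw [lintegral_policyLaw, ENNReal.ofReal_mul he, ENNReal.ofReal_mul he, mul_assoc, ENNReal.ofReal_sum_of_nonneg fun π _ => h0 π]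
  gcongr
  rw [← mul_assoc]
  refine le_mul_of_one_le_left zero_le ?_
  have hne : ((ch.cover m ⟨k, hk'⟩ prev cur c).card : ENNReal) ≠ 0 := by
    exact_mod_cast (cover_nonempty ch _).card_ne_zero
  rw [← ENNReal.mul_inv_cancel hne (ENNReal.natCast_ne_top _)]
  gcongr
  rw [← ENNReal.ofReal_natCast]
  refine ENNReal.ofReal_le_ofReal ?_
  exact_mod_cast card_cover_le ch _

end Cover

/-! ### Measurability of trusted kernels and losses in the context -/

section Measurability

variable {C S A : Type*} [MeasurableSpace C] [Fintype S] [Fintype A] [DecidableEq S] {n : ℕ}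

lemma measurable_occ {s₁ : S} {g : C → ℕ → S → A → S → ℝ} {q : C → ℕ → S → A → ℝ} (k : ℕ)
    (hg : ∀ j < k, ∀ s a s', Measurable fun c => g c j s a s')
    (hq : ∀ j s a, Measurable fun c => q c j s a) (s : S) :
    Measurable fun c => occ s₁ (g c) (q c) k s := by
  induction k generalizing s with
  | zero => exact measurable_const
  | succ k ih =>
    simp only [occ]
    exact Finset.measurable_sum _ fun s' _ => Finset.measurable_sum _ fun a' _ =>
      ((ih (fun j hj => hg j (by omega)) s').mul (hq _ _ _)).mul (hg k (by omega) _ _ _)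

lemma measurable_coe_stdSimplex {X : Type*} [Fintype X] (x : X) :
    Measurable fun v : stdSimplex ℝ X => v.1 x :=
  (measurable_pi_apply x).comp measurable_subtype_coe

lemma measurable_policy_apply {H : ℕ} (h : Fin H) (s : S) (a : A) :
    Measurable fun π : Policy S A H => (π h s).1 a :=
  (measurable_coe_stdSimplex a).comp ((measurable_pi_apply s).comp (measurable_pi_apply h))

lemma measurable_polKer {π : C → Policy S A (n + 1)} (hπ : Measurable π) (k : ℕ) (s : S) (a : A) :
    Measurable fun c => polKer (π c) k s a :=
  (measurable_policy_apply _ s a).comp hπ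

lemma measurable_modelKer (M : CMDP C S A (n + 1)) (k : ℕ) (s : S) (a : A) (s' : S) :
    Measurable fun c => modelKer M c k s a s' :=
  (measurable_coe_stdSimplex s').comp (M.measurable_P _ s a)

lemma measurable_layerHellinger (M M' : CMDP C S A (n + 1)) (k : ℕ) (s : S) (a : A) :
    Measurable fun c => layerHellinger M M' c k s a :=
  measurable_const.sub (Finset.measurable_sum _ fun s' _ =>
    ((measurable_modelKer M k s a s').mul (measurable_modelKer M' k s a s')).sqrt)

variable [MeasurableSpace S] [MeasurableSpace A]
  {p : Params C S A (n + 1)} (ch : Choices p) (m : ℕ) (prev cur M : CMDP C S A (n + 1))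
include ch

lemma measurable_maxOcc_of {k : ℕ} (hk : k < n + 1)
    (h : ∀ j < k, ∀ s a s', Measurable fun c => p.trustedKer m prev cur c j s a s') (s : S) (a : A) :
    Measurable fun c => p.maxOcc m prev cur c k s a := by
  simp only [maxOcc_eq_explore ch hk, Params.trustedPairOcc]
  have hq := measurable_polKer (ch.explore_measurable m ⟨k, hk⟩ prev cur s a)
  exact (measurable_occ k h hq s).mul (hq k s a)

/-- Trust asks for the existence of a policy, but the best one is the measurable `ch.explore`, so
the condition becomes an inequality for `p.maxOcc`. That quantity uses only earlier layers, whence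
the strong induction. -/
lemma measurable_trustedKer (k : ℕ) (s : S) (a : A) (s' : S) :
    Measurable fun c => p.trustedKer m prev cur c k s a s' := by
  induction k using Nat.strong_induction_on generalizing s a s' with
  | _ k ih =>
    by_cases hk : k < n + 1
    · have hT : ∀ c, (∃ hk : k < n + 1,
          p.Trusted m prev cur c ⟨k, hk⟩ (p.trustedOcc m prev cur c k hk) s a s') ↔
          1 / p.ζ m ≤ p.maxOcc m prev cur c k s a /
            ((Fintype.card S : ℝ) * Fintype.card A) * modelKer cur c k s a s' := by
        intro c
        simp only [hk, exists_true_left, Params.Trusted, Params.gap_eq, modelKer,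
          Fin.ofNat_eq_mk hk]
        have hrw : ∀ π : Policy S A (n + 1), p.trustedOcc m prev cur c k hk π s *
            (π ⟨k, hk⟩ s).1 a = p.trustedPairOcc m prev cur c k π s a := fun π => by
          rw [← trustedOccSA_eq _ _ _ _ _ _ hk]; rfl
        simp only [hrw]
        constructor
        · rintro ⟨π, h⟩
          refine h.trans (mul_le_mul_of_nonneg_right ?_ ((cur.P _ s a c).2.1 s'))
          exact div_le_div_of_nonneg_right (trustedPairOcc_le_maxOcc _ _ _ _ _ _ _ _ _)
            (by positivity)
        · intro h
          rw [maxOcc_eq_explore ch hk] at h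
          exact ⟨_, h⟩
      simp only [Params.trustedKer, hT]
      refine Measurable.ite (measurableSet_le measurable_const ?_) (measurable_modelKer cur k s a s')
        measurable_const
      exact ((measurable_maxOcc_of ch m prev cur hk ih s a).div_const _).mul
        (measurable_modelKer cur k s a s')
    · simp [Params.trustedKer, hk]

lemma measurable_loss {k : ℕ} (hk : k < n + 1) :
    Measurable fun c => p.loss m prev cur M c k := by
  have hker := measurable_trustedKer ch m prev cur
  refine Measurable.ite ?_ (Finset.measurable_sum _ fun s _ => Finset.measurable_sum _ fun a _ =>
    (measurable_maxOcc_of ch m prev cur hk (fun j _ => hker j) s a).mul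
      (measurable_layerHellinger M cur k s a)) measurable_const
  simp only [Params.Dominated, Set.ofPred_forall]
  refine .iInter fun j => .iInter fun _ => .iInter fun s => .iInter fun a => .iInter fun s' => ?_
  exact measurableSet_le (hker j s a s') ((measurable_modelKer M j s a s').const_mul _)

end Measurability

/-! ### Measurability of the law on the cover -/

section PolicyLaw

/-- The image forgets repetitions, and where they occur depends on the context. Summing over the
fixed index set and dividing each term by its multiplicity restores a measurable expression. -/
lemma measurable_sum_image {C X ι : Type*} [MeasurableSpace C] [MeasurableSpace X] [Fintype ι]
    [DecidableEq X]
    {f : ι → C → X} (hf : ∀ i, Measurable (f i)) (heq : ∀ i j, MeasurableSet {c | f i c = f j c})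
    {G : X → ENNReal} (hG : Measurable G) :
    Measurable fun c => ∑ x ∈ Finset.univ.image fun i => f i c, G x := by
  have h : ∀ c, ∑ x ∈ Finset.univ.image fun i => f i c, G x =
      ∑ i, G (f i c) / ∑ j, if f j c = f i c then 1 else 0 := by
    intro c
    rw [Finset.sum_comp (fun x => G x / ∑ j, if f j c = x then 1 else 0) fun i => f i c]
    refine Finset.sum_congr rfl fun x hx => ?_
    obtain ⟨i, -, rfl⟩ := Finset.mem_image.1 hx
    rw [Finset.sum_boole, nsmul_eq_mul, ENNReal.mul_div_cancel]
    · rw [Nat.cast_ne_zero, Finset.card_ne_zero]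
      exact ⟨i, by simp⟩
    · exact ENNReal.natCast_ne_top _
  simp only [h]
  refine Finset.measurable_sum _ fun i _ => (hG.comp (hf i)).div
    (Finset.measurable_sum _ fun j _ => Measurable.ite (heq j i) measurable_const measurable_const)

variable {C S A : Type*} [MeasurableSpace C] [Fintype S] [Fintype A] [DecidableEq S] {H : ℕ}

lemma measurableSet_policy_eq {f g : C → Policy S A H} (hf : Measurable f) (hg : Measurable g) :
    MeasurableSet {c | f c = g c} := by
  have h : {c | f c = g c} = ⋂ h, ⋂ s, ⋂ a, {c | (f c h s).1 a = (g c h s).1 a} := by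
    ext c
    simp only [Set.mem_ofPred_eq, Set.mem_iInter]
    refine ⟨fun h _ _ _ => by rw [h], fun h => ?_⟩
    funext i s
    exact Subtype.ext (funext fun a => h i s a)
  rw [h]
  exact .iInter fun h => .iInter fun s => .iInter fun a => measurableSet_eq_fun
    ((measurable_policy_apply h s a).comp hf) ((measurable_policy_apply h s a).comp hg)

variable [MeasurableSpace S] [MeasurableSpace A]

/-- The policies of the cover, indexed by the objectives they maximize. -/
def Choices.coverPolicy {p : Params C S A H} (ch : Choices p) (m : ℕ) (h : Fin H)
    (prev cur : CMDP C S A H) : Option (S × A) → C → Policy S A H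
  | none => ch.greedy prev
  | some sa => ch.explore m h prev cur sa.1 sa.2

lemma measurable_coverPolicy {p : Params C S A H} (ch : Choices p) (m : ℕ) (h : Fin H)
    (prev cur : CMDP C S A H) : ∀ i, Measurable (ch.coverPolicy m h prev cur i)
  | none => ch.greedy_measurable prev
  | some sa => ch.explore_measurable m h prev cur sa.1 sa.2

open Classical in
lemma cover_eq_image {p : Params C S A H} (ch : Choices p) (m : ℕ) (h : Fin H)
    (prev cur : CMDP C S A H) (c : C) :
    ch.cover m h prev cur c = Finset.univ.image fun i => ch.coverPolicy m h prev cur i c := by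
  ext π
  rw [Choices.cover, Finset.mem_insert, Finset.mem_image, Finset.mem_image]
  constructor
  · rintro (rfl | ⟨sa, -, rfl⟩)
    · exact ⟨none, Finset.mem_univ _, rfl⟩
    · exact ⟨some sa, Finset.mem_univ _, rfl⟩
  · rintro ⟨_ | sa, -, rfl⟩
    · exact Or.inl rfl
    · exact Or.inr ⟨sa, Finset.mem_univ _, rfl⟩

lemma measurable_policyLaw {p : Params C S A H} (ch : Choices p) (m : ℕ) (h : Fin H)
    (prev cur : CMDP C S A H) : Measurable fun c => ch.policyLaw m h prev cur c := by
  have hf := measurable_coverPolicy ch m h prev cur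
  have heq := fun i j => measurableSet_policy_eq (hf i) (hf j)
  refine Measure.measurable_of_measurable_coe _ fun B hB => ?_
  have hval : ∀ c, ch.policyLaw m h prev cur c B =
      (∑ x ∈ ch.cover m h prev cur c, (1 : ENNReal))⁻¹ *
        ∑ x ∈ ch.cover m h prev cur c, B.indicator (1 : Policy S A H → ENNReal) x := by
    intro c
    rw [← lintegral_indicator_one hB, lintegral_policyLaw, Finset.sum_const, nsmul_eq_mul, mul_one]
  have hsum : ∀ G : Policy S A H → ENNReal, Measurable G →
      Measurable fun c => ∑ x ∈ ch.cover m h prev cur c, G x := fun G hG => by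
    simp only [cover_eq_image]
    exact measurable_sum_image hf heq hG
  have hmul := (hsum (fun _ => 1) measurable_const).inv.mul (hsum _ (measurable_one.indicator hB))
  rw [funext hval]
  exact hmul

end PolicyLaw

/-! ### Integration against the law of one round -/

section RoundLaw

variable {C S A : Type*} [MeasurableSpace C] [Fintype S] [Fintype A] [DecidableEq S] {H : ℕ}

lemma measurable_trajProb (s₁ : S) (M : CMDP C S A H) (x : Traj S A H) :
    Measurable fun y : C × Policy S A H => trajProb s₁ M y.2 y.1 x := by
  refine (Finset.measurable_prod _ fun h _ => ?_).mul (Finset.measurable_prod _ fun h _ =>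
    (measurable_policy_apply h _ _).comp measurable_snd)
  split_ifs
  · exact measurable_const
  · exact measurable_const
  · exact ((measurable_coe_stdSimplex _).comp (M.measurable_P _ _ _)).comp measurable_fst

lemma measurable_affinity (s₁ : S) (M M' : CMDP C S A H) :
    Measurable fun y : C × Policy S A H => affinity s₁ M M' y.2 y.1 :=
  Finset.measurable_sum _ fun x _ =>
    ((measurable_trajProb s₁ M x).mul (measurable_trajProb s₁ M' x)).sqrt

variable [MeasurableSpace S] [DiscreteMeasurableSpace S] [MeasurableSpace A]
  [DiscreteMeasurableSpace A]

lemma measurable_trajProb_round (s₁ : S) (M : CMDP C S A H) :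
    Measurable fun z : Round C S A H => trajProb s₁ M z.2.1 z.1 z.2.2 := by
  classical
  have h : (fun z : Round C S A H => trajProb s₁ M z.2.1 z.1 z.2.2) = fun z =>
      ∑ x, if z.2.2 = x then trajProb s₁ M z.2.1 z.1 x else 0 := by
    funext z; simp
  rw [h]
  refine Finset.measurable_sum _ fun x _ => Measurable.ite ?_ ?_ measurable_const
  · exact (measurable_snd.comp measurable_snd) (measurableSet_singleton x)
  · exact (measurable_trajProb s₁ M x).comp
      (measurable_fst.prodMk (measurable_fst.comp measurable_snd))

lemma lintegral_map_trajLaw (s₁ : S) (M : CMDP C S A H) (π : Policy S A H) (c : C)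
    {f : Round C S A H → ENNReal} (hf : Measurable f) :
    ∫⁻ z, f z ∂((trajLaw s₁ M π c).map fun x => (c, π, x)) =
      ∑ x, ENNReal.ofReal (trajProb s₁ M π c x) * f (c, π, x) := by
  have hmk : Measurable fun x : Traj S A H => (c, π, x) :=
    measurable_const.prodMk (measurable_const.prodMk measurable_id)
  rw [lintegral_map hf hmk, trajLaw,
    lintegral_finsetSum_measure]
  refine Finset.sum_congr rfl fun x _ => ?_
  rw [lintegral_smul_measure, lintegral_dirac, smul_eq_mul]

lemma measurable_sum_trajProb_mul (s₁ : S) (M : CMDP C S A H) {f : Round C S A H → ENNReal}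
    (hf : Measurable f) : Measurable fun y : C × Policy S A H =>
      ∑ x, ENNReal.ofReal (trajProb s₁ M y.2 y.1 x) * f (y.1, y.2, x) :=
  Finset.measurable_sum _ fun x _ => (measurable_trajProb s₁ M x).ennreal_ofReal.mul
    (hf.comp (measurable_fst.prodMk (measurable_snd.prodMk measurable_const)))

lemma measurable_map_trajLaw (s₁ : S) (M : CMDP C S A H) :
    Measurable fun y : C × Policy S A H => (trajLaw s₁ M y.2 y.1).map fun x => (y.1, y.2, x) := by
  refine Measure.measurable_of_measurable_coe _ fun B hB => ?_
  simp only [← lintegral_indicator_one hB, lintegral_map_trajLaw s₁ M _ _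
    (measurable_one.indicator hB)]
  exact measurable_sum_trajProb_mul s₁ M (measurable_one.indicator hB)

lemma measurable_lintegral_policy {p : C → Measure (Policy S A H)} (hp : Measurable p)
    [∀ c, IsProbabilityMeasure (p c)] {f : C × Policy S A H → ENNReal} (hf : Measurable f) :
    Measurable fun c => ∫⁻ π, f (c, π) ∂(p c) := by
  let κ : ProbabilityTheory.Kernel C (Policy S A H) := ⟨p, hp⟩
  have : ProbabilityTheory.IsMarkovKernel κ := ⟨fun c => inferInstanceAs (IsProbabilityMeasure (p c))⟩
  exact hf.lintegral_kernel_prod_right' (κ := κ)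

lemma lintegral_roundLaw (s₁ : S) (D : Measure C) (M : CMDP C S A H)
    {p : C → Measure (Policy S A H)} (hp : Measurable p) [∀ c, IsProbabilityMeasure (p c)]
    {f : Round C S A H → ENNReal} (hf : Measurable f) :
    ∫⁻ z, f z ∂(roundLaw s₁ D M p) =
      ∫⁻ c, ∫⁻ π, ∑ x, ENNReal.ofReal (trajProb s₁ M π c x) * f (c, π, x) ∂(p c) ∂D := by
  have hK : ∀ c, Measurable fun π => (trajLaw s₁ M π c).map fun x => (c, π, x) := fun c =>
    (measurable_map_trajLaw s₁ M).comp (measurable_const.prodMk measurable_id)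
  have hbind : Measurable fun c =>
      (p c).bind fun π => (trajLaw s₁ M π c).map fun x => (c, π, x) := by
    refine Measure.measurable_of_measurable_coe _ fun B hB => ?_
    simp only [Measure.bind_apply hB (hK _).aemeasurable]
    exact measurable_lintegral_policy hp
      ((Measure.measurable_coe hB).comp (measurable_map_trajLaw s₁ M))
  rw [roundLaw, Measure.lintegral_bind hbind.aemeasurable hf.aemeasurable]
  refine lintegral_congr fun c => ?_
  rw [Measure.lintegral_bind (hK c).aemeasurable hf.aemeasurable]
  exact lintegral_congr fun π => lintegral_map_trajLaw s₁ M π c hf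

end RoundLaw

/-! ### Exponential moments of the Hellinger risk of maximum likelihood -/

section MaximumLikelihood

variable {C S A : Type*} [MeasurableSpace C] [Fintype S] [Fintype A] [DecidableEq S] {n : ℕ}
  [MeasurableSpace S] [DiscreteMeasurableSpace S] [MeasurableSpace A] [DiscreteMeasurableSpace A]
  (s₁ : S) (D : Measure C) [IsProbabilityMeasure D] (M : CMDP C S A (n + 1))
  {p : C → Measure (Policy S A (n + 1))} (hp : Measurable p) [∀ c, IsProbabilityMeasure (p c)]

include hp in
lemma isProbabilityMeasure_roundLaw : IsProbabilityMeasure (roundLaw s₁ D M p) := by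
  constructor
  rw [← lintegral_one, lintegral_roundLaw s₁ D M hp measurable_const]
  simp only [mul_one, ← ENNReal.ofReal_sum_of_nonneg fun _ _ => trajProb_nonneg _ _ _ _ _,
    sum_trajProb, ENNReal.ofReal_one, lintegral_one, measure_univ]

include hp in
lemma ae_trajProb_pos : ∀ᵐ z ∂(roundLaw s₁ D M p), 0 < trajProb s₁ M z.2.1 z.1 z.2.2 := by
  have hset : MeasurableSet {z : Round C S A (n + 1) | ¬ 0 < trajProb s₁ M z.2.1 z.1 z.2.2} :=
    (measurableSet_lt measurable_const (measurable_trajProb_round s₁ M)).compl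
  rw [ae_iff, ← lintegral_indicator_one hset,
    lintegral_roundLaw s₁ D M hp (measurable_one.indicator hset)]
  have h : ∀ c (π : Policy S A (n + 1)), ∑ x, ENNReal.ofReal (trajProb s₁ M π c x) *
      {z : Round C S A (n + 1) | ¬ 0 < trajProb s₁ M z.2.1 z.1 z.2.2}.indicator 1 (c, π, x) =
      0 := by
    intro c π
    refine Finset.sum_eq_zero fun x _ => ?_
    by_cases hx : 0 < trajProb s₁ M π c x
    · rw [Set.indicator_of_notMem (by simpa using hx), mul_zero]
    · rw [ENNReal.ofReal_of_nonpos (not_lt.1 hx), zero_mul]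
  simp only [h, lintegral_zero]

/-- The averaged squared Hellinger distance of the trajectory laws of two models. -/
noncomputable def hellingerRisk (p : C → Measure (Policy S A (n + 1)))
    (M' : CMDP C S A (n + 1)) : ENNReal :=
  ∫⁻ c, ∫⁻ π, ENNReal.ofReal (1 - affinity s₁ M M' π c) ∂(p c) ∂D

/-- The square root of the likelihood ratio of one round. -/
noncomputable def sqrtRatio (M' : CMDP C S A (n + 1)) (z : Round C S A (n + 1)) : ENNReal :=
  ENNReal.ofReal √(trajProb s₁ M' z.2.1 z.1 z.2.2 / trajProb s₁ M z.2.1 z.1 z.2.2)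

lemma measurable_sqrtRatio (M' : CMDP C S A (n + 1)) : Measurable (sqrtRatio s₁ M M') :=
  ((measurable_trajProb_round s₁ M').div (measurable_trajProb_round s₁ M)).sqrt.ennreal_ofReal

include hp in
-- Reweighting the root of the likelihood ratio by the law of M gives √(P P'); trajectories with P =
-- 0 contribute nothing to either side.
lemma lintegral_sqrtRatio (M' : CMDP C S A (n + 1)) :
    ∫⁻ z, sqrtRatio s₁ M M' z ∂(roundLaw s₁ D M p) =
      ∫⁻ c, ∫⁻ π, ENNReal.ofReal (affinity s₁ M M' π c) ∂(p c) ∂D := by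
  rw [lintegral_roundLaw s₁ D M hp (measurable_sqrtRatio s₁ M M')]
  refine lintegral_congr fun c => lintegral_congr fun π => ?_
  rw [affinity, ENNReal.ofReal_sum_of_nonneg fun _ _ => Real.sqrt_nonneg _]
  refine Finset.sum_congr rfl fun x _ => ?_
  rw [sqrtRatio, ← ENNReal.ofReal_mul (trajProb_nonneg _ _ _ _ _)]
  congr 1
  have h0 := trajProb_nonneg s₁ M π c x
  simp only
  set u := trajProb s₁ M π c x
  set v := trajProb s₁ M' π c x
  rcases h0.eq_or_lt with h | h
  · simp [← h]
  · rw [← Real.sqrt_sq h.le, ← Real.sqrt_mul (sq_nonneg _), Real.sqrt_sq h.le]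
    congr 1
    field_simp

include hp in
lemma lintegral_affinity_add_hellingerRisk (M' : CMDP C S A (n + 1)) :
    ∫⁻ c, ∫⁻ π, ENNReal.ofReal (affinity s₁ M M' π c) ∂(p c) ∂D +
      hellingerRisk s₁ D M p M' = 1 := by
  rw [hellingerRisk, ← lintegral_add_left (measurable_lintegral_policy hp
    (measurable_affinity s₁ M M').ennreal_ofReal)]
  have h : ∀ c, ∫⁻ π, ENNReal.ofReal (affinity s₁ M M' π c) ∂(p c) +
      ∫⁻ π, ENNReal.ofReal (1 - affinity s₁ M M' π c) ∂(p c) = 1 := by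
    intro c
    have hm : Measurable fun π => ENNReal.ofReal (affinity s₁ M M' π c) :=
      ((measurable_affinity s₁ M M').comp
        (measurable_const.prodMk measurable_id)).ennreal_ofReal
    rw [← lintegral_add_left hm]
    have : ∀ π, ENNReal.ofReal (affinity s₁ M M' π c) +
        ENNReal.ofReal (1 - affinity s₁ M M' π c) = 1 := fun π => by
      rw [← ENNReal.ofReal_add (affinity_nonneg _ _ _ _ _)
        (sub_nonneg.2 (affinity_le_one _ _ _ _ _))]
      simp
    simp only [this, lintegral_one, measure_univ]
  simp only [h, lintegral_one, measure_univ]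

include hp in
lemma hellingerRisk_le_one (M' : CMDP C S A (n + 1)) : hellingerRisk s₁ D M p M' ≤ 1 :=
  le_of_le_of_eq le_add_self (lintegral_affinity_add_hellingerRisk s₁ D M hp M')

include hp in
-- By independence the integral is (1 - Δ)^N with Δ the Hellinger risk, and 1 - Δ ≤ exp(-Δ).
lemma exp_mul_lintegral_prod_sqrtRatio_le (M' : CMDP C S A (n + 1)) (N : ℕ) :
    ENNReal.ofReal (Real.exp (N * (hellingerRisk s₁ D M p M').toReal)) *
      ∫⁻ data : Fin N → Round C S A (n + 1), ∏ i, sqrtRatio s₁ M M' (data i)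
        ∂(Measure.pi fun _ => roundLaw s₁ D M p) ≤ 1 := by
  have := isProbabilityMeasure_roundLaw s₁ D M hp
  have hmeas := measurable_sqrtRatio s₁ M M'
  have hind := ProbabilityTheory.iIndepFun_pi (ι := Fin N) (μ := fun _ => roundLaw s₁ D M p)
    (X := fun _ => sqrtRatio s₁ M M') fun _ => hmeas.aemeasurable
  rw [ProbabilityTheory.lintegral_prod_eq_prod_lintegral_of_indepFun Finset.univ _ hind
    fun i => hmeas.comp (measurable_pi_apply i)]
  have hone : ∀ i : Fin N, ∫⁻ data : Fin N → Round C S A (n + 1), sqrtRatio s₁ M M' (data i)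
      ∂(Measure.pi fun _ => roundLaw s₁ D M p) =
      ∫⁻ c, ∫⁻ π, ENNReal.ofReal (affinity s₁ M M' π c) ∂(p c) ∂D := fun i => by
    rw [← lintegral_sqrtRatio s₁ D M hp M']
    exact (measurePreserving_eval (fun _ : Fin N => roundLaw s₁ D M p) i).lintegral_comp hmeas
  rw [Finset.prod_congr rfl fun i _ => hone i, Finset.prod_const, Finset.card_univ, Fintype.card_fin]
  have hadd := lintegral_affinity_add_hellingerRisk s₁ D M hp M'
  have hle := hellingerRisk_le_one s₁ D M hp M'
  set Δ := hellingerRisk s₁ D M p M'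
  have hΔ : Δ ≠ ⊤ := ne_top_of_le_ne_top ENNReal.one_ne_top hle
  rw [ENNReal.eq_sub_of_add_eq hΔ hadd, ← ENNReal.ofReal_toReal hΔ, ← ENNReal.ofReal_one,
    ← ENNReal.ofReal_sub _ ENNReal.toReal_nonneg, ENNReal.toReal_ofReal ENNReal.toReal_nonneg]
  have hd : Δ.toReal ≤ 1 := ENNReal.toReal_le_of_le_ofReal zero_le_one (by simpa using hle)
  rw [← ENNReal.ofReal_pow (by linarith), ← ENNReal.ofReal_mul (Real.exp_pos _).le]
  refine ENNReal.ofReal_le_ofReal ?_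
  have h1 : (1 - Δ.toReal) ^ N ≤ Real.exp (-Δ.toReal) ^ N :=
    pow_le_pow_left₀ (by linarith) (Real.one_sub_le_exp_neg _) N
  rw [← Real.exp_nat_mul] at h1
  calc _ ≤ Real.exp (N * Δ.toReal) * Real.exp (N * -Δ.toReal) :=
        mul_le_mul_of_nonneg_left h1 (Real.exp_pos _).le
    _ = 1 := by rw [← Real.exp_add]; simp

include hp in
/-- Exponential moment bound for the Hellinger risk of a maximum likelihood estimator. -/
lemma lintegral_exp_hellingerRisk_le (𝓜 : Finset (CMDP C S A (n + 1))) (hM : M ∈ 𝓜) (N : ℕ)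
    (est : (Fin N → Round C S A (n + 1)) → CMDP C S A (n + 1)) (hmem : ∀ data, est data ∈ 𝓜)
    (hmax : ∀ data, ∀ M' ∈ 𝓜, likelihood s₁ M' data ≤ likelihood s₁ (est data) data) :
    ∫⁻ data, ENNReal.ofReal (Real.exp (N * (hellingerRisk s₁ D M p (est data)).toReal))
      ∂(Measure.pi fun _ => roundLaw s₁ D M p) ≤ 𝓜.card := by
  have := isProbabilityMeasure_roundLaw s₁ D M hp
  have hpos : ∀ᵐ data ∂(Measure.pi fun _ : Fin N => roundLaw s₁ D M p),
      ∀ i, 0 < trajProb s₁ M (data i).2.1 (data i).1 (data i).2.2 :=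
    ae_all_iff.2 fun i => (Measure.tendsto_eval_ae_ae (μ := fun _ : Fin N => roundLaw s₁ D M p)
      (i := i)).eventually (ae_trajProb_pos s₁ D M hp)
  have hprod : ∀ M', Measurable fun data : Fin N → Round C S A (n + 1) =>
      ∏ i, sqrtRatio s₁ M M' (data i) := fun M' => Finset.measurable_prod _ fun i _ =>
    (measurable_sqrtRatio s₁ M M').comp (measurable_pi_apply i)
  calc _ ≤ ∫⁻ data, ∑ M' ∈ 𝓜, ENNReal.ofReal
        (Real.exp (N * (hellingerRisk s₁ D M p M').toReal)) * ∏ i, sqrtRatio s₁ M M' (data i)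
        ∂(Measure.pi fun _ => roundLaw s₁ D M p) := by
        -- The true model belongs to the class, so the likelihood ratio of the estimate against it
        -- is at least 1 and may be inserted as a factor. Passing to the sum over the whole class
        -- then removes the dependence of the model on the data.
        refine lintegral_mono_ae (hpos.mono fun data hdata => ?_)
        refine le_trans ?_ (Finset.single_le_sum (f := fun M' => ENNReal.ofReal
          (Real.exp (N * (hellingerRisk s₁ D M p M').toReal)) * ∏ i, sqrtRatio s₁ M M' (data i))
          (fun _ _ => zero_le) (hmem data))
        refine le_mul_of_one_le_right zero_le ?_
        simp only [sqrtRatio]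
        rw [← ENNReal.ofReal_prod_of_nonneg fun _ _ => Real.sqrt_nonneg _, ← ENNReal.ofReal_one]
        refine ENNReal.ofReal_le_ofReal ?_
        rw [← Real.sqrt_prod _ fun i _ => div_nonneg (trajProb_nonneg _ _ _ _ _)
          (trajProb_nonneg _ _ _ _ _), Real.one_le_sqrt, Finset.prod_div_distrib,
          one_le_div (Finset.prod_pos fun i _ => hdata i)]
        exact hmax data M hM
    _ = ∑ M' ∈ 𝓜, ENNReal.ofReal (Real.exp (N * (hellingerRisk s₁ D M p M').toReal)) *
        ∫⁻ data : Fin N → Round C S A (n + 1), ∏ i, sqrtRatio s₁ M M' (data i)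
        ∂(Measure.pi fun _ => roundLaw s₁ D M p) := by
        rw [lintegral_finsetSum _ fun M' _ => (hprod M').const_mul _]
        exact Finset.sum_congr rfl fun M' _ => lintegral_const_mul _ (hprod M')
    _ ≤ ∑ M' ∈ 𝓜, 1 := Finset.sum_le_sum fun M' _ =>
        exp_mul_lintegral_prod_sqrtRatio_le s₁ D M hp M' N
    _ = 𝓜.card := by simp

end MaximumLikelihood

/-! ### Almost sure statements along composed kernels -/

section Bind

variable {α β : Type*} [MeasurableSpace α] [MeasurableSpace β]

lemma ae_bind_of_ae {μ : Measure α} {κ : α → Measure β} (hκ : Measurable κ) {P : α → Prop}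
    {Q : β → Prop} (hQ : MeasurableSet {y | ¬ Q y}) (hP : ∀ᵐ x ∂μ, P x)
    (h : ∀ x, P x → ∀ᵐ y ∂(κ x), Q y) : ∀ᵐ y ∂(μ.bind κ), Q y := by
  rw [ae_iff, Measure.bind_apply hQ hκ.aemeasurable]
  rw [lintegral_congr_ae (hP.mono fun x hx => ae_iff.1 (h x hx)), lintegral_zero]

end Bind

/-! ### Segments and epochs: accumulation of the layer losses -/

section Segments

variable {C S A : Type*} [MeasurableSpace C] [Fintype S] [Fintype A] [DecidableEq S] {n : ℕ}
  [MeasurableSpace S] [DiscreteMeasurableSpace S] [MeasurableSpace A] [DiscreteMeasurableSpace A]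
  {p : Params C S A (n + 1)} (ch : Choices p) (D : Measure C) [IsProbabilityMeasure D]
  (M : CMDP C S A (n + 1)) (m : ℕ)

/-- The state after a segment with the given data. -/
def Choices.nextState (ch : Choices p) (st : State C S A (n + 1)) (h : Fin (n + 1)) {N : ℕ}
    (data : Fin N → Round C S A (n + 1)) : State C S A (n + 1) where
  prev := st.prev
  cur := st.cur.replaceLayer (ch.oracle _ data) h
  trajectories := st.trajectories + N
  calls := st.calls + 1

/-- The oracle has finitely many values, each on a measurable set of data, so the discrete σ-algebra
on states is harmless. -/
lemma measurable_nextState (st : State C S A (n + 1)) (h : Fin (n + 1)) (N : ℕ) :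
    Measurable (ch.nextState st h (N := N)) := by
  classical
  intro E _
  let f : CMDP C S A (n + 1) → State C S A (n + 1) := fun M' =>
    ⟨st.prev, st.cur.replaceLayer M' h, st.trajectories + N, st.calls + 1⟩
  have hE : ch.nextState st h (N := N) ⁻¹' E =
      ⋃ M' ∈ p.𝓜.filter fun M' => f M' ∈ E, {data | ch.oracle N data = M'} := by
    ext data
    simp only [Set.mem_preimage, Set.mem_iUnion, Finset.mem_filter, exists_prop]
    constructor
    · intro hd
      exact ⟨ch.oracle N data, ⟨ch.oracle_mem N data, hd⟩, rfl⟩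
    · rintro ⟨M', ⟨-, hM'⟩, hd⟩
      obtain rfl : ch.oracle N data = M' := hd
      exact hM'
  rw [hE]
  exact Finset.measurableSet_biUnion _ fun M' _ => ch.oracle_measurable N M'

lemma segment_eq (st : State C S A (n + 1)) (h : Fin (n + 1)) :
    ch.segment D M m st h = (Measure.pi fun _ : Fin (p.τ m - p.τ (m - 1)) =>
      roundLaw p.s₁ D M (ch.policyLaw m h st.prev st.cur)).map (ch.nextState st h) :=
  rfl

instance (st : State C S A (n + 1)) (h : Fin (n + 1)) :
    IsProbabilityMeasure (ch.segment D M m st h) := by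
  have := isProbabilityMeasure_roundLaw p.s₁ D M (measurable_policyLaw ch m h st.prev st.cur)
  rw [segment_eq]
  exact Measure.isProbabilityMeasure_map (measurable_nextState ch st h _).aemeasurable

lemma lintegral_segment (st : State C S A (n + 1)) (h : Fin (n + 1))
    (G : State C S A (n + 1) → ENNReal) :
    ∫⁻ st', G st' ∂(ch.segment D M m st h) = ∫⁻ data, G (ch.nextState st h data)
      ∂(Measure.pi fun _ : Fin (p.τ m - p.τ (m - 1)) =>
        roundLaw p.s₁ D M (ch.policyLaw m h st.prev st.cur)) := by
  rw [segment_eq, lintegral_map measurable_from_top (measurable_nextState ch st h _)]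

/-- The law of the state after running the segments in the list `l`. -/
noncomputable def Choices.segments (l : List (Fin (n + 1))) (st : State C S A (n + 1)) :
    Measure (State C S A (n + 1)) :=
  l.foldl (fun μ h => μ.bind fun st' => ch.segment D M m st' h) (Measure.dirac st)

lemma segments_append (l : List (Fin (n + 1))) (h : Fin (n + 1)) (st : State C S A (n + 1)) :
    ch.segments D M m (l ++ [h]) st =
      (ch.segments D M m l st).bind fun st' => ch.segment D M m st' h := by
  simp [Choices.segments]

instance (l : List (Fin (n + 1))) (st : State C S A (n + 1)) :
    IsProbabilityMeasure (ch.segments D M m l st) := by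
  induction l using List.reverseRecOn with
  | nil => exact Measure.dirac.isProbabilityMeasure
  | append_singleton l h ih =>
    rw [segments_append]
    exact isProbabilityMeasure_bind measurable_from_top.aemeasurable (.of_forall inferInstance)

lemma ae_segments (l : List (Fin (n + 1))) (st : State C S A (n + 1)) :
    ∀ᵐ st' ∂(ch.segments D M m l st),
      st'.trajectories = st.trajectories + l.length * (p.τ m - p.τ (m - 1)) ∧
        st'.calls = st.calls + l.length := by
  induction l using List.reverseRecOn with
  | nil => simp [Choices.segments, ae_dirac_eq]
  | append_singleton l h ih =>
    rw [segments_append]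
    refine ae_bind_of_ae measurable_from_top MeasurableSpace.measurableSet_top ih
      fun st' hst' => ?_
    rw [segment_eq, ae_map_iff (measurable_nextState ch st' h _).aemeasurable
      MeasurableSpace.measurableSet_top]
    refine .of_forall fun data => ?_
    simp only [Choices.nextState, hst'.1, hst'.2, List.length_append, List.length_singleton]
    constructor <;> ring

/-- The expected loss of a layer over the contexts. -/
noncomputable def Params.layerRisk (p : Params C S A (n + 1)) (st : State C S A (n + 1)) (k : ℕ) :
    ENNReal :=
  ∫⁻ c, ENNReal.ofReal (p.loss m st.prev st.cur M c k) ∂D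

/-- The expected loss of a layer, if its transitions are ever observed. -/
noncomputable def Params.observedRisk (p : Params C S A (n + 1)) (st : State C S A (n + 1))
    (h : Fin (n + 1)) : ℝ :=
  if h.val < n then (p.layerRisk D M m st h).toReal else 0

lemma loss_le_card (prev cur : CMDP C S A (n + 1)) (c : C) (k : ℕ) :
    p.loss m prev cur M c k ≤ (Fintype.card S : ℝ) * Fintype.card A := by
  rw [Params.loss]
  split_ifs
  · calc _ ≤ ∑ _s : S, ∑ _a : A, (1 : ℝ) := by
          refine Finset.sum_le_sum fun s _ => Finset.sum_le_sum fun a _ => ?_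
          have h1 : p.maxOcc m prev cur c k s a ≤ 1 :=
            Real.iSup_le (fun π => trustedPairOcc_le_one p m prev cur c k π s a) zero_le_one
          have h2 : layerHellinger M cur c k s a ≤ 1 :=
            sub_le_self _ (Finset.sum_nonneg fun s' _ => affKer_nonneg _ _ _ _)
          exact mul_le_one₀ h1 (layerHellinger_nonneg _ _ _ _ _ _) h2
      _ = _ := by simp
  · positivity

lemma layerRisk_ne_top (st : State C S A (n + 1)) (k : ℕ) : p.layerRisk D M m st k ≠ ⊤ := by
  refine ne_top_of_le_ne_top (b := ENNReal.ofReal ((Fintype.card S : ℝ) * Fintype.card A))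
    ENNReal.ofReal_ne_top ?_
  calc _ ≤ ∫⁻ _, ENNReal.ofReal ((Fintype.card S : ℝ) * Fintype.card A) ∂D :=
        lintegral_mono fun c => ENNReal.ofReal_le_ofReal (loss_le_card M m _ _ c k)
    _ = _ := by simp

/-- The factor by which the expected loss of a layer may exceed the Hellinger risk. -/
noncomputable def coverFactor (S A : Type*) [Fintype S] [Fintype A] : ℝ :=
  2 * Real.exp 1 * ((Fintype.card S : ℝ) * Fintype.card A + 1)

lemma coverFactor_pos : 0 < coverFactor S A := by
  unfold coverFactor; positivity

/-- The cover bound integrated over contexts. The last layer is set to 0, since no next state is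
observed there and none affects the return. -/
lemma observedRisk_nextState_le (st : State C S A (n + 1)) (h : Fin (n + 1)) {N : ℕ}
    (data : Fin N → Round C S A (n + 1)) :
    p.observedRisk D M m (ch.nextState st h data) h ≤ coverFactor S A *
      (hellingerRisk p.s₁ D M (ch.policyLaw m h st.prev st.cur) (ch.oracle N data)).toReal := by
  have hp := measurable_policyLaw ch m h st.prev st.cur
  rw [Params.observedRisk]
  split_ifs with hn
  · rw [← ENNReal.toReal_ofReal coverFactor_pos.le, ← ENNReal.toReal_mul]
    refine ENNReal.toReal_mono (ENNReal.mul_ne_top ENNReal.ofReal_ne_top (ne_top_of_le_ne_top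
      ENNReal.one_ne_top (hellingerRisk_le_one p.s₁ D M hp _))) ?_
    rw [hellingerRisk, ← lintegral_const_mul _ (measurable_lintegral_policy hp
      (f := fun y => ENNReal.ofReal (1 - affinity p.s₁ M (ch.oracle N data) y.2 y.1))
      (measurable_const.sub (measurable_affinity p.s₁ M _)).ennreal_ofReal)]
    exact lintegral_mono fun c => ofReal_loss_replaceLayer_le ch hn h.isLt
  · exact mul_nonneg coverFactor_pos.le ENNReal.toReal_nonneg

lemma observedRisk_nextState_of_lt (st : State C S A (n + 1)) {j h : Fin (n + 1)} (hj : j < h)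
    {N : ℕ} (data : Fin N → Round C S A (n + 1)) :
    p.observedRisk D M m (ch.nextState st h data) j = p.observedRisk D M m st j := by
  rw [Params.observedRisk, Params.observedRisk]
  congr 2
  refine lintegral_congr fun c => ?_
  congr 1
  refine loss_congr j.isLt fun i hi => replaceLayer_P_of_ne _ _ ?_
  rintro rfl
  exact absurd hj (not_lt.2 hi)

lemma lintegral_segment_exp_le (hM : M ∈ p.𝓜) (st : State C S A (n + 1)) (h : Fin (n + 1)) :
    ∫⁻ st', ENNReal.ofReal (Real.exp (((p.τ m - p.τ (m - 1) : ℕ) : ℝ) / coverFactor S A *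
      p.observedRisk D M m st' h)) ∂(ch.segment D M m st h) ≤ p.𝓜.card := by
  rw [lintegral_segment]
  refine le_trans (lintegral_mono fun data => ?_) (lintegral_exp_hellingerRisk_le p.s₁ D M
    (measurable_policyLaw ch m h st.prev st.cur) p.𝓜 hM (p.τ m - p.τ (m - 1)) (ch.oracle _)
    (ch.oracle_mem _) (ch.oracle_max _))
  refine ENNReal.ofReal_le_ofReal (Real.exp_le_exp.2 ?_)
  have h1 := observedRisk_nextState_le ch D M m st h data
  have h2 := coverFactor_pos (S := S) (A := A)
  calc _ ≤ ((p.τ m - p.τ (m - 1) : ℕ) : ℝ) / coverFactor S A * (coverFactor S A *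
      (hellingerRisk p.s₁ D M (ch.policyLaw m h st.prev st.cur) (ch.oracle _ data)).toReal) :=
        mul_le_mul_of_nonneg_left h1 (by positivity)
    _ = _ := by field_simp

/-- The moment bound of a segment holds conditionally on any state before it, and the losses
accumulated so far are constants for the new segment. So each segment contributes one factor |𝓜|. -/
lemma lintegral_segments_exp_le (hM : M ∈ p.𝓜) (st : State C S A (n + 1))
    (l : List (Fin (n + 1))) (hl : l.Pairwise (· < ·)) :
    ∫⁻ st', ENNReal.ofReal (Real.exp (((p.τ m - p.τ (m - 1) : ℕ) : ℝ) / coverFactor S A *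
      (l.map fun h => p.observedRisk D M m st' h).sum)) ∂(ch.segments D M m l st) ≤
      (p.𝓜.card : ENNReal) ^ l.length := by
  induction l using List.reverseRecOn with
  | nil => simp
  | append_singleton l h ih =>
    rw [List.pairwise_append] at hl
    set r := ((p.τ m - p.τ (m - 1) : ℕ) : ℝ) / coverFactor S A
    rw [segments_append, Measure.lintegral_bind measurable_from_top.aemeasurable
      measurable_from_top.aemeasurable]
    have hstep : ∀ st₁ : State C S A (n + 1), ∫⁻ st', ENNReal.ofReal (Real.exp (r *
        ((l ++ [h]).map fun h => p.observedRisk D M m st' h).sum)) ∂(ch.segment D M m st₁ h) ≤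
        ENNReal.ofReal (Real.exp (r * (l.map fun h => p.observedRisk D M m st₁ h).sum)) *
          p.𝓜.card := by
      intro st₁
      refine le_trans (le_of_eq ?_) (mul_le_mul_right
        (lintegral_segment_exp_le ch D M m hM st₁ h) _)
      rw [← lintegral_const_mul _ measurable_from_top, lintegral_segment, lintegral_segment]
      refine lintegral_congr fun data => ?_
      rw [← ENNReal.ofReal_mul (Real.exp_pos _).le, ← Real.exp_add]
      -- Here the increasing order of the layers is used: the new segment comes after all those in
      -- `l`.
      have hmap : (l.map fun j => p.observedRisk D M m (ch.nextState st₁ h data) j) =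
          l.map fun j => p.observedRisk D M m st₁ j :=
        List.map_congr_left fun j hj =>
          observedRisk_nextState_of_lt ch D M m st₁ (hl.2.2 j hj h (by simp)) data
      rw [List.map_append, List.sum_append, hmap, mul_add]
      simp [r]
    refine (lintegral_mono hstep).trans ?_
    rw [lintegral_mul_const _ measurable_from_top, List.length_append, List.length_singleton,
      pow_succ]
    exact mul_le_mul_left (ih hl.1) _

lemma epoch_eq (st : State C S A (n + 1)) :
    ch.epoch D M m st = ch.segments D M m (List.finRange (n + 1)) { st with prev := st.cur } :=
  rfl

/-- With high probability the layers estimated in an epoch have a small total loss. -/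
lemma epoch_le_delta (hM : M ∈ p.𝓜) (hτ : 0 < p.τ m - p.τ (m - 1)) {δ : ℝ} (hδ : 0 < δ)
    (hδ1 : δ ≤ 1) (st : State C S A (n + 1)) :
    ch.epoch D M m st {st' | coverFactor S A * (n + 1) * Real.log (p.𝓜.card / δ) /
      ((p.τ m - p.τ (m - 1) : ℕ) : ℝ) ≤
        ∑ k ∈ Finset.range n, (p.layerRisk D M m st' k).toReal} ≤ ENNReal.ofReal δ := by
  have hmoment := lintegral_segments_exp_le ch D M m hM { st with prev := st.cur }
    (List.finRange (n + 1)) (List.pairwise_lt_finRange _)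
  have hsum : ∀ st' : State C S A (n + 1),
      ((List.finRange (n + 1)).map fun h => p.observedRisk D M m st' h).sum =
        ∑ k ∈ Finset.range n, (p.layerRisk D M m st' k).toReal := by
    intro st'
    rw [← List.ofFn_eq_map, List.sum_ofFn, Fin.sum_univ_castSucc, Finset.sum_range]
    simp [Params.observedRisk]
  simp only [hsum, List.length_finRange] at hmoment
  rw [← epoch_eq] at hmoment
  have hN : (0 : ℝ) < ((p.τ m - p.τ (m - 1) : ℕ) : ℝ) := by exact_mod_cast hτ
  have hc := coverFactor_pos (S := S) (A := A)
  have hcard : (0 : ℝ) < p.𝓜.card := by exact_mod_cast Finset.card_pos.2 ⟨M, hM⟩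
  set N := ((p.τ m - p.τ (m - 1) : ℕ) : ℝ)
  set F : State C S A (n + 1) → ℝ := fun st' =>
    ∑ k ∈ Finset.range n, (p.layerRisk D M m st' k).toReal
  -- The threshold is chosen so that the exponential reaches (|𝓜|/δ)^H on the bad event.
  have hexp : ∀ st', coverFactor S A * (n + 1) * Real.log (p.𝓜.card / δ) / N ≤ F st' →
      ENNReal.ofReal ((p.𝓜.card / δ) ^ (n + 1)) ≤
        ENNReal.ofReal (Real.exp (N / coverFactor S A * F st')) := by
    intro st' h
    refine ENNReal.ofReal_le_ofReal ?_
    rw [← Real.exp_log (div_pos hcard hδ), ← Real.exp_nat_mul, Real.exp_le_exp]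
    rw [div_le_iff₀ hN] at h
    rw [div_mul_eq_mul_div, le_div_iff₀ hc]
    push_cast
    linarith
  have hmarkov := mul_meas_ge_le_lintegral (μ := ch.epoch D M m st)
    (measurable_from_top (f := fun st' => ENNReal.ofReal (Real.exp (N / coverFactor S A * F st'))))
    (ENNReal.ofReal ((p.𝓜.card / δ) ^ (n + 1)))
  have hle := (mul_le_mul_right (measure_mono (μ := ch.epoch D M m st) (fun st' h => hexp st' h))
    _).trans (hmarkov.trans hmoment)
  -- Against the moment |𝓜|^H, Markov's inequality leaves the failure probability δ^H ≤ δ.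
  have hpow : (p.𝓜.card : ENNReal) ^ (n + 1) =
      ENNReal.ofReal ((p.𝓜.card / δ) ^ (n + 1)) * ENNReal.ofReal (δ ^ (n + 1)) := by
    rw [← ENNReal.ofReal_mul (by positivity), ← mul_pow, div_mul_cancel₀ _ hδ.ne',
      ENNReal.ofReal_pow hcard.le, ENNReal.ofReal_natCast]
  rw [hpow, ENNReal.mul_le_mul_iff_right (by positivity) ENNReal.ofReal_ne_top] at hle
  exact hle.trans (ENNReal.ofReal_le_ofReal (pow_le_of_le_one hδ.le hδ1 (by simp)))

include ch in
/-- A small total loss makes the estimated model good for all rewards. -/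
lemma rewardFreeObjective_of_layerRisk_le (st : State C S A (n + 1)) (hζ : 0 < p.ζ m) {t B : ℝ}
    (ht : 0 < t) (hB : ∑ k ∈ Finset.range n, (p.layerRisk D M m st k).toReal ≤ B) {ε : ℝ}
    (hε : t * (n + 1) +
      2 * (n + 1) * ((Fintype.card S : ℝ) ^ 3 * (Fintype.card A : ℝ) ^ 2 / p.ζ m) +
      (8 / t + 32 * ((n : ℝ) + 1) ^ 2 * p.ζ m / ((Fintype.card S : ℝ) * Fintype.card A)) * B ≤ ε) :
    RewardFreeObjective p.s₁ D M st.cur ε := by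
  intro R π hR
  set b := t * (n + 1) +
    2 * (n + 1) * ((Fintype.card S : ℝ) ^ 3 * (Fintype.card A : ℝ) ^ 2 / p.ζ m)
  set w := 8 / t + 32 * ((n : ℝ) + 1) ^ 2 * p.ζ m / ((Fintype.card S : ℝ) * Fintype.card A)
  have hb : 0 ≤ b := by positivity
  have hw : 0 ≤ w := by positivity
  have hloss := loss_nonneg p m st.prev st.cur M
  calc _ ≤ ∫⁻ c, ENNReal.ofReal b + ENNReal.ofReal w *
        ∑ k ∈ Finset.range n, ENNReal.ofReal (p.loss m st.prev st.cur M c k) ∂D := by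
        -- The dominating function is free of R and π. Hence the estimate holds for all of them at
        -- once, and neither family has to be measurable in the context.
        refine lintegral_mono_ae (hR.mono fun c hc => ?_)
        rw [← ENNReal.ofReal_sum_of_nonneg fun k _ => hloss c k, ← ENNReal.ofReal_mul hw,
          ← ENNReal.ofReal_add hb (mul_nonneg hw (Finset.sum_nonneg fun k _ => hloss c k))]
        exact ENNReal.ofReal_le_ofReal (abs_value_sub_le hζ ht hc.1 hc.2 (π c))
    _ = ENNReal.ofReal b + ENNReal.ofReal w *
        ∑ k ∈ Finset.range n, p.layerRisk D M m st k := by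
        rw [lintegral_add_left measurable_const, lintegral_const_mul' _ _ ENNReal.ofReal_ne_top,
          lintegral_finsetSum _ fun k hk => (measurable_loss ch m st.prev st.cur M
            (by have := Finset.mem_range.1 hk; omega)).ennreal_ofReal]
        simp [Params.layerRisk]
    _ ≤ ENNReal.ofReal b + ENNReal.ofReal w * ENNReal.ofReal B := by
        gcongr
        rw [← ENNReal.ofReal_toReal (ENNReal.sum_ne_top.2 fun k _ => layerRisk_ne_top D M m st k),
          ENNReal.toReal_sum fun k _ => layerRisk_ne_top D M m st k]
        exact ENNReal.ofReal_le_ofReal hB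
    _ ≤ ENNReal.ofReal ε := by
        have hB0 : 0 ≤ B := (Finset.sum_nonneg fun k _ => ENNReal.toReal_nonneg).trans hB
        rw [← ENNReal.ofReal_mul hw, ← ENNReal.ofReal_add hb (mul_nonneg hw hB0)]
        exact ENNReal.ofReal_le_ofReal hε

end Segments

/-! ### The run over several epochs -/

section Run

variable {C S A : Type*} [MeasurableSpace C] [Fintype S] [Fintype A] [DecidableEq S] {n : ℕ}
  [MeasurableSpace S] [DiscreteMeasurableSpace S] [MeasurableSpace A] [DiscreteMeasurableSpace A]
  {p : Params C S A (n + 1)} (ch : Choices p) (D : Measure C) [IsProbabilityMeasure D]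
  (M : CMDP C S A (n + 1))

instance (m : ℕ) (st : State C S A (n + 1)) : IsProbabilityMeasure (ch.epoch D M m st) := by
  rw [epoch_eq]; infer_instance

lemma isProbabilityMeasure_run (m : ℕ) : IsProbabilityMeasure (ch.run D M m) := by
  induction m with
  | zero => exact Measure.dirac.isProbabilityMeasure
  | succ m ih =>
    exact isProbabilityMeasure_bind measurable_from_top.aemeasurable (.of_forall inferInstance)

lemma ae_run (m : ℕ) : ∀ᵐ st ∂(ch.run D M m),
    st.trajectories = (∑ i ∈ Finset.range m, (n + 1) * (p.τ (i + 1) - p.τ i)) ∧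
      st.calls = m * (n + 1) := by
  induction m with
  | zero => simp [Choices.run, ae_dirac_eq]
  | succ m ih =>
    refine ae_bind_of_ae measurable_from_top MeasurableSpace.measurableSet_top ih fun st hst => ?_
    rw [epoch_eq]
    refine (ae_segments ch D M (m + 1) _ _).mono fun st' hst' => ?_
    rw [hst'.1, hst'.2, List.length_finRange, Finset.sum_range_succ, hst.1, hst.2]
    exact ⟨rfl, by ring⟩

/-- A failure bound uniform in the starting state of the last epoch needs no information on the
earlier ones. -/
lemma le_run_succ (m : ℕ) (E : Set (State C S A (n + 1))) {δ : ENNReal}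
    (h : ∀ st, ch.epoch D M (m + 1) st Eᶜ ≤ δ) : 1 - δ ≤ ch.run D M (m + 1) E := by
  have := isProbabilityMeasure_run ch D M m
  have hE : MeasurableSet E := MeasurableSpace.measurableSet_top
  calc 1 - δ = ∫⁻ _, (1 - δ) ∂(ch.run D M m) := by simp
    _ ≤ ∫⁻ st, ch.epoch D M (m + 1) st E ∂(ch.run D M m) := by
        refine lintegral_mono fun st => ?_
        rw [tsub_le_iff_right, ← prob_add_prob_compl (μ := ch.epoch D M (m + 1) st) hE]
        gcongr
        exact h st
    _ = ch.run D M (m + 1) E := by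
        rw [Choices.run, Measure.bind_apply hE measurable_from_top.aemeasurable]

end Run

/-! ### Balancing the error terms -/

section Numerics

/-- The ratio between the accuracy `ε` and the statistical scale that suffices. -/
noncomputable def accuracyRatio (κ : ℝ) : ℝ := 40 + 1536 * √κ + 64 / √κ

/-- The deleted mass. With (H + 1)² ≤ 4H² and e ≤ 3 the constant is 16 · 3 · 4 · 2 = 384 = 1536/4.
-/
lemma untrusted_term_le {H s a e r w G X ζ ε : ℝ} (hH : 1 ≤ H) (hs : 0 < s) (ha : 0 < a)
    (he : 0 < e) (he3 : e ≤ 3) (hG : 0 < G) (hX : H ^ 4 * s ^ 3 * a ^ 2 ≤ X)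
    (hGX : X ≤ 2 * (r * w * G)) (hw : 1536 * r * w ≤ ε) (hζ : ζ = G / (8 * e * H * (H + 1) ^ 2)) :
    2 * H * (s ^ 3 * a ^ 2 / ζ) ≤ ε / 4 := by
  have hH0 : 0 < H := by linarith
  have hH1 : (H + 1) ^ 2 ≤ 4 * H ^ 2 := by nlinarith
  have h1 : 2 * H * (s ^ 3 * a ^ 2 / ζ) =
      16 * e * H ^ 2 * (H + 1) ^ 2 * s ^ 3 * a ^ 2 / G := by
    rw [hζ]; field_simp; norm_num
  rw [h1, div_le_iff₀ hG]
  calc 16 * e * H ^ 2 * (H + 1) ^ 2 * s ^ 3 * a ^ 2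
      ≤ 16 * 3 * H ^ 2 * (4 * H ^ 2) * s ^ 3 * a ^ 2 := by gcongr
    _ = 192 * (H ^ 4 * s ^ 3 * a ^ 2) := by ring
    _ ≤ 192 * (2 * (r * w * G)) := by linarith
    _ = 1536 * r * w / 4 * G := by ring
    _ ≤ ε / 4 * G := by gcongr

/-- The estimation error at t = ε/(4H). It is at most 384w²/ε, and 40² ≥ 4 · 384. -/
lemma variance_term_le {H b e w X v ε : ℝ} (hH : 0 < H) (hb : 1 ≤ b) (he : 0 < e)
    (he3 : e ≤ 3) (hX0 : 0 < X) (hX : H ^ 2 * b ≤ X) (hv : v = w ^ 2 / X) (hw0 : 0 < w)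
    (hw : 40 * w ≤ ε) : 8 / (ε / (4 * H)) * (2 * e * (b + 1) * H * v) ≤ ε / 4 := by
  have hε : 0 < ε := by linarith
  have h1 : 8 / (ε / (4 * H)) * (2 * e * (b + 1) * H * v) =
      64 * e * (H ^ 2 * (b + 1)) * v / ε := by
    field_simp; ring
  have h2 : H ^ 2 * (b + 1) ≤ 2 * X := by nlinarith [sq_nonneg H]
  rw [h1, hv, div_le_iff₀ hε, ← mul_div_assoc, div_le_iff₀ hX0]
  have h3 : (40 * w) ^ 2 ≤ ε ^ 2 := pow_le_pow_left₀ (by positivity) hw 2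
  have h4 : 384 * w ^ 2 ≤ ε / 4 * ε := by nlinarith [sq_nonneg w]
  calc 64 * e * (H ^ 2 * (b + 1)) * w ^ 2 ≤ 64 * 3 * (2 * X) * w ^ 2 := by gcongr
    _ = 384 * w ^ 2 * X := by ring
    _ ≤ ε / 4 * ε * X := by gcongr

/-- The contexts without domination. The factor e in ζ cancels that of the cover bound, leaving
16w/√κ; this gives the constant 64/√κ. -/
lemma bad_context_term_le {H b e r w G X v ζ ε : ℝ} (hH : 0 < H) (hb : 1 ≤ b) (he : 0 < e)
    (hr : 0 < r) (hw0 : 0 < w) (hG : 0 < G) (hX0 : 0 < X) (hv : v = w ^ 2 / X)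
    (hGX : r * w * G ≤ X) (hw : 64 * w ≤ ε * r) (hζ : ζ = G / (8 * e * H * (H + 1) ^ 2)) :
    32 * H ^ 2 * ζ / b * (2 * e * (b + 1) * H * v) ≤ ε / 4 := by
  have hb0 : 0 < b := by linarith
  have h1 : 32 * H ^ 2 * ζ / b * (2 * e * (b + 1) * H * v) =
      8 * (H ^ 2 / (H + 1) ^ 2) * ((b + 1) / b) * (G * v) := by
    rw [hζ]; field_simp; ring
  have h2 : H ^ 2 / (H + 1) ^ 2 ≤ 1 := by
    rw [div_le_one (by positivity)]; nlinarith
  have h3 : (b + 1) / b ≤ 2 := by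
    rw [div_le_iff₀ hb0]; linarith
  have h4 : G * v ≤ w / r := by
    rw [hv, ← mul_div_assoc, div_le_div_iff₀ hX0 hr]
    nlinarith [mul_le_mul_of_nonneg_left hGX hw0.le]
  have hv0 : 0 < v := by rw [hv]; positivity
  rw [h1]
  calc _ ≤ 8 * 1 * 2 * (w / r) := by gcongr
    _ ≤ ε / 4 := by
        rw [← mul_div_assoc, div_le_iff₀ hr]; linarith

/-- Put X = H⁶S⁴A³, let w = √(Xl/N) be the statistical scale and G = √(X/(κL/N)) the parameter γ.
Then √κ · w · G = X√(l/L) lies between X/2 and X. The deleted mass needs G large and the bad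
contexts need G small; both are of order w at this G, and each of the four terms is at most ε/4. -/
lemma error_budget {H s a N l L κ ε : ℝ} (hH : 1 ≤ H) (hs : 1 ≤ s) (ha : 1 ≤ a) (hN : 0 < N)
    (hl : 0 < l) (hlL : l ≤ L) (hL : L ≤ 4 * l) (hκ : 0 < κ) (hε : 0 < ε)
    (hlarge : accuracyRatio κ ^ 2 * (H ^ 6 * s ^ 4 * a ^ 3 * l) ≤ ε ^ 2 * N) {ζ : ℝ}
    (hζ : ζ = √(H ^ 6 * s ^ 4 * a ^ 3 / (κ * L / N)) / (8 * Real.exp 1 * H * (H + 1) ^ 2)) :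
    ε / (4 * H) * H + 2 * H * (s ^ 3 * a ^ 2 / ζ) +
      (8 / (ε / (4 * H)) + 32 * H ^ 2 * ζ / (s * a)) *
        (2 * Real.exp 1 * (s * a + 1) * H * l / N) ≤ ε := by
  have hH0 : 0 < H := by linarith
  have hs0 : 0 < s := by linarith
  have ha0 : 0 < a := by linarith
  have hL0 : 0 < L := by linarith
  have he0 : 0 < Real.exp 1 := Real.exp_pos 1
  have he3 : Real.exp 1 ≤ 3 := by linarith [Real.exp_one_lt_d9]
  set e := Real.exp 1
  have hr0 : 0 < √κ := Real.sqrt_pos.2 hκ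
  have hr2 : √κ ^ 2 = κ := Real.sq_sqrt hκ.le
  unfold accuracyRatio at hlarge
  set r := √κ
  clear_value e r
  obtain ⟨X, hX⟩ : ∃ X, X = H ^ 6 * s ^ 4 * a ^ 3 := ⟨_, rfl⟩
  rw [← hX] at hζ hlarge
  have hX0 : 0 < X := by rw [hX]; positivity
  have hsa : 1 ≤ s * a := one_le_mul_of_one_le_of_one_le hs ha
  have hX1 : H ^ 4 * s ^ 3 * a ^ 2 ≤ X := by
    have h1 : H ^ 4 ≤ H ^ 6 := pow_le_pow_right₀ hH (by norm_num)
    have h2 : s ^ 3 ≤ s ^ 4 := pow_le_pow_right₀ hs (by norm_num)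
    have h3 : a ^ 2 ≤ a ^ 3 := pow_le_pow_right₀ ha (by norm_num)
    rw [hX]; gcongr
  have hX2 : H ^ 2 * (s * a) ≤ X := by
    have h1 : H ^ 2 ≤ H ^ 6 := pow_le_pow_right₀ hH (by norm_num)
    have h2 : s ≤ s ^ 4 := le_self_pow₀ hs (by norm_num)
    have h3 : a ≤ a ^ 3 := le_self_pow₀ ha (by norm_num)
    rw [hX, ← mul_assoc]; gcongr
  obtain ⟨w, hw⟩ : ∃ w, w = √(X * l / N) := ⟨_, rfl⟩
  have hw0 : 0 < w := by rw [hw]; positivity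
  have hw2 : w ^ 2 = X * l / N := by rw [hw]; exact Real.sq_sqrt (by positivity)
  have hwε : w * (40 + 1536 * r + 64 / r) ≤ ε := by
    rw [← pow_le_pow_iff_left₀ (by positivity) hε.le two_ne_zero, mul_pow, hw2, mul_comm,
      ← mul_div_assoc, div_le_iff₀ hN]
    exact hlarge
  have hwε1 : 40 * w ≤ ε := by
    have : 0 ≤ w * (1536 * r + 64 / r) := by positivity
    linarith
  have hwε2 : 1536 * r * w ≤ ε := by
    have : 0 ≤ w * (40 + 64 / r) := by positivity
    linarith
  have hwε3 : 64 * w ≤ ε * r := by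
    have : 0 ≤ w * (40 + 1536 * r) := by positivity
    have h1 : w * (64 / r) ≤ ε := by linarith
    rw [← mul_div_assoc, div_le_iff₀ hr0] at h1
    linarith
  obtain ⟨G, hG⟩ : ∃ G, G = √(X / (κ * L / N)) := ⟨_, rfl⟩
  rw [← hG] at hζ
  have hG0 : 0 < G := by rw [hG]; positivity
  have hG2 : G ^ 2 = X / (κ * L / N) := by rw [hG]; exact Real.sq_sqrt (by positivity)
  have hprod : (r * w * G) ^ 2 = X ^ 2 * (l / L) := by
    rw [mul_pow, mul_pow, hr2, hw2, hG2]; field_simp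
  have hG_lower : X ≤ 2 * (r * w * G) := by
    rw [← pow_le_pow_iff_left₀ hX0.le (by positivity) two_ne_zero, mul_pow, hprod]
    have : 1 ≤ 4 * (l / L) := by
      rw [← mul_div_assoc, le_div_iff₀ hL0]; linarith
    nlinarith [mul_le_mul_of_nonneg_left this (sq_nonneg X)]
  have hG_upper : r * w * G ≤ X := by
    rw [← pow_le_pow_iff_left₀ (by positivity) hX0.le two_ne_zero, hprod]
    exact mul_le_of_le_one_right (sq_nonneg X) ((div_le_one hL0).2 hlL)
  have hv : l / N = w ^ 2 / X := by rw [hw2]; field_simp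
  have hterm1 : ε / (4 * H) * H = ε / 4 := by field_simp
  have hterm2 := untrusted_term_le hH hs0 ha0 he0 he3 hG0 hX1 hG_lower hwε2 hζ
  have hterm3 := variance_term_le hH0 hsa he0 he3 hX0 hX2 hv hw0 hwε1
  have hterm4 := bad_context_term_le hH0 hsa he0 hr0 hw0 hG0 hX0 hv hG_upper hwε3 hζ
  rw [add_mul, mul_div_assoc (2 * e * (s * a + 1) * H)]
  linarith

/-- Rounding up to a multiple of d adds less than d, which is at most q. -/
lemma exists_dvd_between {d : ℕ} (hd : 0 < d) {q : ℝ} (hq : (d : ℝ) ≤ q) :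
    ∃ T : ℕ, d ∣ T ∧ q ≤ T ∧ (T : ℝ) ≤ 2 * q := by
  have hd0 : (0 : ℝ) < d := by exact_mod_cast hd
  refine ⟨d * ⌈q / d⌉₊, dvd_mul_right _ _, ?_, ?_⟩
  · push_cast
    have := Nat.le_ceil (q / d)
    rw [div_le_iff₀ hd0] at this
    linarith
  · push_cast
    have := Nat.ceil_lt_add_one (a := q / d) (div_nonneg (hd0.le.trans hq) hd0.le)
    have h2 := mul_lt_mul_of_pos_left this hd0
    rw [mul_add, mul_div_cancel₀ _ hd0.ne'] at h2
    linarith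

end Numerics

end Lolipop

/-! ### The theorem -/

open MeasureTheory Lolipop
theorem theorem6p1 (κ : ℝ) (hκ : 0 < κ) :
    ∃ K : ℝ, 0 < K ∧
      ∀ (C : Type*) [MeasurableSpace C]
        (S : Type*) [Fintype S] [DecidableEq S] [MeasurableSpace S] [DiscreteMeasurableSpace S]
        (A : Type*) [Fintype A] [Nonempty A] [MeasurableSpace A] [DiscreteMeasurableSpace A]
        (H : ℕ) (s₁ : S) (D : Measure C) [IsProbabilityMeasure D]
        (𝓜 : Finset (CMDP C S A H)) (M : CMDP C S A H) (ε δ : ℝ),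
        1 ≤ H → M ∈ 𝓜 → 0 < ε → 0 < δ → δ < 1 / 2 →
        (∀ T : ℕ, 2 * H ∣ T →
          K * sampleSize H (Fintype.card S) (Fintype.card A) 𝓜.card ε δ ≤ T →
          ∀ ch : Choices (p := (⟨s₁, 𝓜, 2, twoEpochs H T, κ, δ⟩ : Params C S A H)),
            IsProbabilityMeasure (ch.run D M 2) ∧
            ENNReal.ofReal (1 - δ) ≤
              ch.run D M 2 {st | RewardFreeObjective s₁ D M st.cur ε} ∧
            ∀ᵐ st ∂(ch.run D M 2), st.trajectories = T ∧ st.calls = 2 * H) ∧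
        (ε ≤ 1 → ∃ T : ℕ, 2 * H ∣ T ∧
          K * sampleSize H (Fintype.card S) (Fintype.card A) 𝓜.card ε δ ≤ T ∧
          T ≤ 2 * K * sampleSize H (Fintype.card S) (Fintype.card A) 𝓜.card ε δ) := by
  have hR40 : 40 ≤ accuracyRatio κ := by
    have : 0 ≤ 1536 * √κ + 64 / √κ := by positivity
    unfold accuracyRatio
    linarith
  -- The factor 2, together with one power of H from the sample size, absorbs the division of T into
  -- 2H segments of length N = T/(2H).
  refine ⟨2 * accuracyRatio κ ^ 2, by positivity, ?_⟩
  intro C _ S _ _ _ _ A _ _ _ _ H s₁ D _ 𝓜 M ε δ hH hM hε hδ hδ2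
  obtain ⟨n, rfl⟩ : ∃ n, H = n + 1 := ⟨H - 1, by omega⟩
  have hHr : ((n + 1 : ℕ) : ℝ) = (n : ℝ) + 1 := by push_cast; ring
  have hH1 : (1 : ℝ) ≤ (n : ℝ) + 1 := by simp
  have hs : (1 : ℝ) ≤ Fintype.card S := by exact_mod_cast Fintype.card_pos_iff.2 ⟨s₁⟩
  have ha : (1 : ℝ) ≤ Fintype.card A := by exact_mod_cast Fintype.card_pos (α := A)
  have hcard : (1 : ℝ) ≤ 𝓜.card := by exact_mod_cast Finset.card_pos.2 ⟨M, hM⟩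
  -- From δ < 1/2 and |𝓜| ≥ 1. This lets the constant log 8 below be absorbed into l.
  have hl2 : Real.log 2 ≤ Real.log (𝓜.card / δ) := by
    refine Real.log_le_log two_pos ?_
    rw [le_div_iff₀ hδ]
    linarith
  have hlog2 : 1 / 2 < Real.log 2 := by linarith [Real.log_two_gt_d9]
  unfold sampleSize
  rw [hHr]
  set l := Real.log (𝓜.card / δ) with hl_def
  have hl0 : 0 < l := by linarith
  constructor
  · rintro T ⟨N, rfl⟩ hT ch
    have hτ1 : twoEpochs (n + 1) (2 * (n + 1) * N) 1 = N := by simp [twoEpochs]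
    have hτ2 : twoEpochs (n + 1) (2 * (n + 1) * N) 2 = 2 * N := by
      simp only [twoEpochs]
      rw [mul_comm 2 (n + 1), mul_assoc, Nat.mul_div_cancel_left _ (by omega)]
    have hτ0 : twoEpochs (n + 1) (2 * (n + 1) * N) 0 = 0 := rfl
    refine ⟨isProbabilityMeasure_run ch D M 2, ?_, ?_⟩
    · have hNlarge : accuracyRatio κ ^ 2 * (((n : ℝ) + 1) ^ 6 * (Fintype.card S : ℝ) ^ 4 *
          (Fintype.card A : ℝ) ^ 3 * l) ≤ ε ^ 2 * N := by
        rw [← mul_div_assoc, div_le_iff₀ (by positivity)] at hT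
        push_cast at hT
        have h1 : 2 * ((n : ℝ) + 1) * (accuracyRatio κ ^ 2 * (((n : ℝ) + 1) ^ 6 *
            (Fintype.card S : ℝ) ^ 4 * (Fintype.card A : ℝ) ^ 3 * l)) ≤
            2 * ((n : ℝ) + 1) * (ε ^ 2 * N) := by
          linarith
        exact le_of_mul_le_mul_left h1 (by positivity)
      have hN0 : (0 : ℝ) < N := by
        have h1 : 0 < accuracyRatio κ ^ 2 * (((n : ℝ) + 1) ^ 6 * (Fintype.card S : ℝ) ^ 4 *
          (Fintype.card A : ℝ) ^ 3 * l) := by positivity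
        exact pos_of_mul_pos_right (h1.trans_le hNlarge) (sq_nonneg ε)
      -- The error rate is taken at confidence δ/(2 · 2²) = δ/8, so its logarithm is L = l + 3 log
      -- 2, with l ≤ L ≤ 4l.
      have hL : Real.log (𝓜.card / (δ / (2 * ((2 : ℕ) : ℝ) ^ 2))) = 3 * Real.log 2 + l := by
        have h8 : (𝓜.card : ℝ) / (δ / (2 * ((2 : ℕ) : ℝ) ^ 2)) = 2 ^ 3 * (𝓜.card / δ) := by
          push_cast; field_simp
        rw [h8, Real.log_mul (by norm_num) (by positivity), Real.log_pow, ← hl_def]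
        norm_num
      have hlen : twoEpochs (n + 1) (2 * (n + 1) * N) 2 -
          twoEpochs (n + 1) (2 * (n + 1) * N) (2 - 1) = N := by
        rw [hτ2, show 2 - 1 = 1 from rfl, hτ1]; omega
      have hN : N ≠ 0 := by exact_mod_cast hN0.ne'
      -- The rate in epoch 2 refers to the segment length τ 1 - τ 0 of epoch 1, which equals N, the
      -- segment length of epoch 2.
      have hζ : (⟨s₁, 𝓜, 2, twoEpochs (n + 1) (2 * (n + 1) * N), κ, δ⟩ :
          Params C S A (n + 1)).ζ 2 = √(((n : ℝ) + 1) ^ 6 * (Fintype.card S : ℝ) ^ 4 *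
          (Fintype.card A : ℝ) ^ 3 / (κ * (3 * Real.log 2 + l) / N)) /
          (8 * Real.exp 1 * ((n : ℝ) + 1) * ((n : ℝ) + 1 + 1) ^ 2) := by
        simp only [Params.ζ, Params.γ, Params.err, mleRate, hL, hHr, Nat.add_one_sub_one,
          Nat.sub_self, hτ1, hτ0, Nat.sub_zero, if_neg hN]
      have hζ0 : 0 < (⟨s₁, 𝓜, 2, twoEpochs (n + 1) (2 * (n + 1) * N), κ, δ⟩ :
          Params C S A (n + 1)).ζ 2 := by
        rw [hζ]; positivity
      rw [ENNReal.ofReal_sub 1 hδ.le, ENNReal.ofReal_one]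
      refine le_run_succ ch D M 1 _ fun st => (measure_mono fun st' hst' => ?_).trans
        (epoch_le_delta ch D M 2 hM (by rw [hlen]; omega) hδ (by linarith) st)
      by_contra hlt
      refine hst' (rewardFreeObjective_of_layerRisk_le ch D M 2 st' hζ0
        (t := ε / (4 * ((n : ℝ) + 1))) (by positivity) (not_le.1 hlt).le ?_)
      rw [hlen]
      exact error_budget hH1 hs ha hN0 hl0 (by linarith) (by linarith) hκ hε hNlarge hζ
    · refine (ae_run ch D M 2).mono fun st hst => ⟨hst.1.trans ?_, hst.2⟩
      simp only [Finset.sum_range_succ, Finset.sum_range_zero, zero_add, hτ0, hτ1, hτ2,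
        Nat.reduceAdd]
      have : 2 * N - N = N := by omega
      rw [this, Nat.sub_zero]
      ring
  · intro hε1
    -- For ε ≤ 1 the sample size is at least H/2 because l > 1/2, so rounding to a multiple of 2H
    -- costs at most a factor 2.
    have hbig : ((2 * (n + 1) : ℕ) : ℝ) ≤ 2 * accuracyRatio κ ^ 2 * (((n : ℝ) + 1) ^ 7 *
        (Fintype.card S : ℝ) ^ 4 * (Fintype.card A : ℝ) ^ 3 * l / ε ^ 2) := by
      have h1 : (n : ℝ) + 1 ≤ ((n : ℝ) + 1) ^ 7 := le_self_pow₀ hH1 (by norm_num)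
      have h2 : (1 : ℝ) ≤ (Fintype.card S : ℝ) ^ 4 := one_le_pow₀ hs
      have h3 : (1 : ℝ) ≤ (Fintype.card A : ℝ) ^ 3 := one_le_pow₀ ha
      have h4 : ((n : ℝ) + 1) * 1 * 1 * (1 / 2) / 1 ≤ ((n : ℝ) + 1) ^ 7 *
          (Fintype.card S : ℝ) ^ 4 * (Fintype.card A : ℝ) ^ 3 * l / ε ^ 2 := by
        gcongr
        · linarith
        · exact pow_le_one₀ hε.le hε1
      have h5 : (2 * 40 ^ 2 : ℝ) ≤ 2 * accuracyRatio κ ^ 2 := by gcongr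
      calc ((2 * (n + 1) : ℕ) : ℝ) ≤ 2 * 40 ^ 2 * (((n : ℝ) + 1) * 1 * 1 * (1 / 2) / 1) := by
            push_cast; linarith
        _ ≤ _ := by gcongr
    obtain ⟨T, h1, h2, h3⟩ := exists_dvd_between (by omega) hbig
    exact ⟨T, h1, h2, by linarith⟩
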